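/- Let $\sigma>0$ be irrational with simple continued fraction expansion $\sigma=[c_0,c_1,c_2,\ldots]$ ($c_0\ge 0$ and $c_i\ge 1$ for $i\ge1$). Let $k_1\ge 0$ be an arbitrary integer, and let $$(k_i)_{i\ge1}=(k_1,\,c_0,\,\underbrace{0,\ldots,0}_{c_1-1},\,c_2,\,\underbrace{0,\ldots,0}_{c_3-1},\,c_4,\,\ldots),$$ that is, for $p\ge 0$, $k_i=c_{2p}$ if $i=c_1+c_3+\cdots+c_{2p-1}+2$, and $k_i=0$ if $c_1+\cdots+c_{2p-1}+2<i<c_1+\cdots+c_{2p+1}+2$. Let $\Lambda$ be the small category with objects $v_1,v_2,\ldots$ generated by morphisms $\alpha_i,\beta_i,\gamma_i^{(j)}$ ($i\ge1$, $1\le j\le k_i$) with range $v_i$ and source $v_{i+1}$, subject to the relations $\alpha_i\beta_{i+1}=\beta_i\alpha_{i+1}$; write $r(\mu)$, $s(\mu)$ for the range and source of a morphism $\mu$. A nonempty subset $x$ of $\Lambda$ is directed if any two of its elements have a common extension in $x$, and hereditary if it contains all prefixes of its elements. Let $\Lambda^*$ be the set of nonempty directed hereditary subsets of $\Lambda$ (all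 elements of such an $x$ have the same range $r(x)$). Put $Z(\mu)=\{x\in\Lambda^*:\mu\in x\}$, and give $\Lambda^*$ the topology with base the sets $Z(\mu)\setminus\bigcup_{i=1}^n Z(\nu_i)$. Let $\partial\Lambda$ be the closure of the set of maximal elements of $\Lambda^*$, and $X=\{x\in\partial\Lambda: r(x)=v_1\}$. For $x\in\Lambda^*$ with $r(x)=s(\mu)$ let $\mu x\in\Lambda^*$ be the set of all prefixes of the elements $\mu\nu$, $\nu\in x$. Let $G$ be the groupoid with unit space $X$ whose elements are the classes $[\mu,\nu,x]$ with $\mu,\nu\in\Lambda$, $r(\mu)=r(\nu)=v_1$, $s(\mu)=s(\nu)=r(x)$ and $x\in\partial\Lambda$, for the equivalence relation generated by $(\mu,\nu,\eta x)\sim(\mu\eta,\nu\eta,x)$; its range and source maps are $[\mu,\nu,x]\mapsto\mu x$ and $[\mu,\nu,x]\mapsto\nu x$, its product is determined by $[\mu,\nu,x][\nu,\eta,x]=[\mu,\eta,x]$, and its topology has as base the sets $\{[\mu,\nu,x]:x\in E\cap\partial\Lambda\}$ with $E\subseteq\Lambda^*$ compact open and $r(x)=s(\nu)$ for all $x\in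 E$. A Borel measure $m$ on $X$ is invariant if $m(s(E))=m(r(E))$ for every open bisection $E\subseteq G$. Then the limit $\theta=[0,1,k_1,1,k_2,1,k_3,\ldots]=\lim_n p_n/q_n$ of the continued fraction exists (zero coefficients are allowed; $p_n/q_n$ are the convergents given by the usual recurrences), there is exactly one invariant Borel probability measure $m$ on $X$, and $m(X\setminus Z(\beta_1))=\theta$. -/

import Mathlib

open CategoryTheory MeasureTheory Filter Topology

/-! ### Directed hereditary sets and the groupoid of a category of paths

Conventions: a morphism `μ : u ⟶ w` is a path with range `u` and source `w`, and the product `μν`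
of the literature is `μ ≫ ν`. -/

namespace PathCat

universe v u

variable {C : Type u} [Category.{v} C]

/-- The set `uΛ` of all paths with range `u`. -/
abbrev From (u : C) := Σ w : C, (u ⟶ w)

/-- `a` is a prefix of `b`, i.e. `b ∈ aΛ`. -/
def IsPrefix {u : C} (a b : From u) : Prop := ∃ η : a.1 ⟶ b.1, a.2 ≫ η = b.2

/-- `uΛ*`: the (nonempty) directed hereditary subsets of `Λ` with range `u`. -/
@[ext] structure DirHer (u : C) where
  carrier : Set (From u)
  nonempty : carrier.Nonempty
  directed : ∀ a ∈ carrier, ∀ b ∈ carrier, ∃ d ∈ carrier, IsPrefix a d ∧ IsPrefix b d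
  hereditary : ∀ a ∈ carrier, ∀ b, IsPrefix b a → b ∈ carrier

/-- The generalized cylinder set `Z(μ)`. -/
def Z {u : C} (a : From u) : Set (DirHer u) := {x | a ∈ x.carrier}

/-- The topology on `uΛ*` with base the sets `Z(μ) \ (Z(ν₁) ∪ ⋯ ∪ Z(νₙ))`. -/
instance (u : C) : TopologicalSpace (DirHer u) :=
  TopologicalSpace.generateFrom
    {U | ∃ (a : From u) (F : Set (From u)), F.Finite ∧ U = Z a \ ⋃ b ∈ F, Z b}

/-- The Borel σ-algebra on `uΛ*`. -/
instance (u : C) : MeasurableSpace (DirHer u) := borel _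

instance (u : C) : BorelSpace (DirHer u) := ⟨rfl⟩

/-- `u∂Λ`: the closure of the set of maximal directed hereditary sets with range `u`. -/
def boundary (u : C) : Set (DirHer u) :=
  closure {x | ∀ y : DirHer u, x.carrier ⊆ y.carrier → y.carrier ⊆ x.carrier}

theorem IsPrefix.refl {u : C} (a : From u) : IsPrefix a a := ⟨𝟙 _, Category.comp_id _⟩

theorem IsPrefix.trans {u : C} {a b d : From u} (h : IsPrefix a b) (h' : IsPrefix b d) :
    IsPrefix a d := by
  obtain ⟨η, hη⟩ := h
  obtain ⟨ζ, hζ⟩ := h'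
  exact ⟨η ≫ ζ, by rw [← Category.assoc, hη, hζ]⟩

/-- The path `μν`, for `ν ∈ s(μ)Λ`. -/
def pre {u w : C} (μ : u ⟶ w) (a : From w) : From u := ⟨a.1, μ ≫ a.2⟩

theorem IsPrefix.pre {u w : C} (μ : u ⟶ w) {a b : From w} (h : IsPrefix a b) :
    IsPrefix (pre μ a) (pre μ b) := by
  obtain ⟨η, hη⟩ := h
  exact ⟨η, by simp only [PathCat.pre]; rw [Category.assoc, hη]⟩

/-- `μx = ⋃ {[μν] : ν ∈ x}`, for `x ∈ s(μ)Λ*`. -/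
def act {u w : C} (μ : u ⟶ w) (x : DirHer w) : DirHer u where
  carrier := {a | ∃ b ∈ x.carrier, IsPrefix a (pre μ b)}
  nonempty := by
    obtain ⟨b, hb⟩ := x.nonempty
    exact ⟨pre μ b, b, hb, IsPrefix.refl _⟩
  directed := by
    rintro a ⟨b, hb, hab⟩ a' ⟨b', hb', hab'⟩
    obtain ⟨d, hd, h1, h2⟩ := x.directed b hb b' hb'
    exact ⟨pre μ d, ⟨d, hd, IsPrefix.refl _⟩, hab.trans (h1.pre μ), hab'.trans (h2.pre μ)⟩
  hereditary := by
    rintro a ⟨b, hb, hab⟩ a' ha'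
    exact ⟨b, hb, ha'.trans hab⟩

theorem act_comp {u w w' : C} (μ : u ⟶ w) (η : w ⟶ w') (x : DirHer w') :
    act (μ ≫ η) x = act μ (act η x) := by
  ext a
  constructor
  · rintro ⟨b, hb, η', h⟩
    exact ⟨pre η b, ⟨b, hb, IsPrefix.refl _⟩, η', by simpa [pre] using h⟩
  · rintro ⟨b, ⟨d, hd, hbd⟩, hab⟩
    refine ⟨d, hd, hab.trans ?_⟩
    obtain ⟨ζ, hζ⟩ := hbd.pre μ
    exact ⟨ζ, by simpa [pre] using hζ⟩

/-- Triples `(μ, ν, x)` with `s(μ) = s(ν) = r(x)` and `r(μ) = r(ν) = u`. -/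
structure Triple (u : C) where
  vertex : C
  fst : u ⟶ vertex
  snd : u ⟶ vertex
  pt : DirHer vertex

/-- The relation `(μ, ν, ηx) ∼ (μη, νη, x)`. -/
inductive Triple.Rel {u : C} : Triple u → Triple u → Prop
  | step {w w' : C} (μ ν : u ⟶ w) (η : w ⟶ w') (x : DirHer w') :
      Triple.Rel ⟨w, μ, ν, act η x⟩ ⟨w', μ ≫ η, ν ≫ η, x⟩

/-- The restriction of `G(Λ)` to `uΛ*`: the classes `[μ, ν, x]` with `r(μ) = r(ν) = u`, for the
equivalence relation generated by `(μ, ν, ηx) ∼ (μη, νη, x)` (which preserves `r(μ)` and `r(ν)`). -/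
def Arrows (u : C) := Quot (Triple.Rel (u := u))

/-- The arrow `[μ, ν, x]`. -/
def Arrows.mk {u w : C} (μ ν : u ⟶ w) (x : DirHer w) : Arrows u := Quot.mk _ ⟨w, μ, ν, x⟩

/-- The range map `[μ, ν, x] ↦ μx`. -/
def Arrows.range {u : C} : Arrows u → DirHer u :=
  Quot.lift (fun t => act t.fst t.pt) (by rintro _ _ ⟨μ, ν, η, x⟩; exact (act_comp μ η x).symm)

/-- The source map `[μ, ν, x] ↦ νx`. -/
def Arrows.source {u : C} : Arrows u → DirHer u :=
  Quot.lift (fun t => act t.snd t.pt) (by rintro _ _ ⟨μ, ν, η, x⟩; exact (act_comp ν η x).symm)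

/-- The topology with base the sets `[μ, ν, E]`, for `E ⊆ s(ν)Λ*` compact open. -/
instance (u : C) : TopologicalSpace (Arrows u) :=
  TopologicalSpace.generateFrom
    {U | ∃ (w : C) (μ ν : u ⟶ w) (E : Set (DirHer w)),
      IsCompact E ∧ IsOpen E ∧ U = Arrows.mk μ ν '' E}

/-- The groupoid `G(Λ)|_{u∂Λ}`, with the subspace topology: the arrows of `G(Λ)` whose range and
source lie in `u∂Λ`. Its unit space is `u∂Λ`. -/
abbrev BdryGroupoid (u : C) :=
  {g : Arrows u // g.range ∈ boundary u ∧ g.source ∈ boundary u}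

/-- The range map of `G(Λ)|_{u∂Λ}`. -/
def BdryGroupoid.range {u : C} (g : BdryGroupoid u) : boundary u := ⟨g.1.range, g.2.1⟩

/-- The source map of `G(Λ)|_{u∂Λ}`. -/
def BdryGroupoid.source {u : C} (g : BdryGroupoid u) : boundary u := ⟨g.1.source, g.2.2⟩

/-- Open bisections: open sets of arrows on which the range and source maps are injective. -/
def IsOpenBisection {u : C} (E : Set (BdryGroupoid u)) : Prop :=
  IsOpen E ∧ Set.InjOn BdryGroupoid.range E ∧ Set.InjOn BdryGroupoid.source E

/-- Invariance of a Borel measure on the unit space: `m(s(E)) = m(r(E))` for all open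
bisections `E`. -/
def IsInvariant {u : C} (m : Measure (boundary u)) : Prop :=
  ∀ E : Set (BdryGroupoid u), IsOpenBisection E →
    m (BdryGroupoid.source '' E) = m (BdryGroupoid.range '' E)

end PathCat

/-! ### The category of paths `Λ` attached to `(k_i)` -/

/-- The paths in `Λ` from `v_{i+1}` to `v_{n+1}` (range `v_{i+1}`, source `v_{n+1}`) in normal form
`α^{p₀}β^{q₀} γ α^{p₁}β^{q₁} γ ⋯ γ α^{p_m}β^{q_m}`, where `p_t, q_t ≥ 0`, each `α^pβ^q` is an
element of the 2-graph `Λ₁` (determined by its range and its degree `(p, q)`), and each `γ` is an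
edge of the 1-graph `Λ₂`. There are `k_{l+1}` edges `γ` with range `v_{l+1}` and source `v_{l+2}`.
The number `k 0` is not used. -/
inductive Word (k : ℕ → ℕ) : ℕ → ℕ → Type
  | last {i n : ℕ} (p q : ℕ) (h : i + p + q = n) : Word k i n
  | cons {i l n : ℕ} (p q : ℕ) (h : i + p + q = l) (j : Fin (k (l + 1))) (w : Word k (l + 1) n) :
      Word k i n

namespace Word

variable {k : ℕ → ℕ}

/-- Concatenation; adjacent factors in `Λ₁` are multiplied in `Λ₁`. -/
def comp : {i l n : ℕ} → Word k i l → Word k l n → Word k i n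
  | _, _, _, last p q h, last p' q' h' => last (p + p') (q + q') (by omega)
  | _, _, _, last p q h, cons p' q' h' j w => cons (p + p') (q + q') (by omega) j w
  | _, _, _, cons p q h j w, w' => cons p q h j (comp w w')

theorem id_comp {i n : ℕ} (w : Word k i n) : comp (last 0 0 rfl) w = w := by
  cases w <;> simp [comp]

theorem comp_id {i n : ℕ} (w : Word k i n) : comp w (last 0 0 rfl) = w := by
  induction w with
  | last p q h => simp [comp]
  | cons p q h j w ih => simp [comp, ih]

theorem assoc {i l m n : ℕ} (w : Word k i l) (w' : Word k l m) (w'' : Word k m n) :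
    comp (comp w w') w'' = comp w (comp w' w'') := by
  induction w with
  | last p q h => cases w' <;> cases w'' <;> simp [comp, Nat.add_assoc]
  | cons p q h j w ih => simp [comp, ih]

end Word

/-- The objects of `Λ`: `⟨n⟩` is the vertex `v_{n+1}`. -/
structure Lam (k : ℕ → ℕ) where
  idx : ℕ

namespace Lam

variable {k : ℕ → ℕ}

/-- The category of paths `Λ`, the amalgamation of `Λ₁` and `Λ₂` over their vertices. -/
instance : Category (Lam k) where
  Hom a b := Word k a.idx b.idx
  id _ := .last 0 0 rfl
  comp f g := Word.comp f g
  id_comp f := Word.id_comp f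
  comp_id f := Word.comp_id f
  assoc f g h := Word.assoc f g h

/-- The edge `α_{n+1}`. -/
def α (n : ℕ) : (⟨n⟩ : Lam k) ⟶ ⟨n + 1⟩ := Word.last 1 0 rfl

/-- The edge `β_{n+1}`. -/
def β (n : ℕ) : (⟨n⟩ : Lam k) ⟶ ⟨n + 1⟩ := Word.last 0 1 rfl

/-- The edges `γ_{n+1}^{(j)}`. -/
def γ (n : ℕ) (j : Fin (k (n + 1))) : (⟨n⟩ : Lam k) ⟶ ⟨n + 1⟩ :=
  Word.cons 0 0 rfl j (Word.last 0 0 rfl)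

/-! The remaining facts of this section confirm that `Λ` is the category presented by the edges
`α_i`, `β_i`, `γ_i^{(j)}` and the relations `α_i β_{i+1} = β_i α_{i+1}`: the relations hold, every
path is a product of edges, and every assignment of morphisms of another category to the edges that
respects the relations extends to a functor. -/

theorem α_β (n : ℕ) : (α n ≫ β (n + 1) : (⟨n⟩ : Lam k) ⟶ ⟨n + 2⟩) = β n ≫ α (n + 1) := rfl

theorem induction_edges {P : ∀ {a b : Lam k}, (a ⟶ b) → Prop} (hid : ∀ a : Lam k, P (𝟙 a))
    (hα : ∀ (n : ℕ) (b : Lam k) (f : (⟨n + 1⟩ : Lam k) ⟶ b), P f → P (α n ≫ f))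
    (hβ : ∀ (n : ℕ) (b : Lam k) (f : (⟨n + 1⟩ : Lam k) ⟶ b), P f → P (β n ≫ f))
    (hγ : ∀ (n : ℕ) (j : Fin (k (n + 1))) (b : Lam k) (f : (⟨n + 1⟩ : Lam k) ⟶ b),
      P f → P (γ n j ≫ f)) {a b : Lam k} (f : a ⟶ b) : P f := by
  obtain ⟨i⟩ := a
  obtain ⟨n⟩ := b
  change Word k i n at f
  induction f with
  | last p q h =>
    rename_i i n
    induction p generalizing i with
    | zero =>
      induction q generalizing i with
      | zero => obtain rfl : i = n := h; exact hid _
      | succ q ih =>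
        have := hβ i ⟨n⟩ _ (ih (i := i + 1) (by omega))
        simpa only [β, CategoryStruct.comp, Word.comp, Nat.add_comm, Nat.add_zero] using this
    | succ p ih =>
      have := hα i ⟨n⟩ _ (ih (i := i + 1) (by omega))
      simpa only [α, CategoryStruct.comp, Word.comp, Nat.add_comm, Nat.add_zero] using this
  | cons p q h j w ihw =>
    rename_i i l n
    induction p generalizing i with
    | zero =>
      induction q generalizing i with
      | zero => obtain rfl : i = l := h; exact (by
          have := hγ i j ⟨n⟩ _ ihw
          simp only [γ, CategoryStruct.comp, Word.comp] at this
          rwa [Word.id_comp] at this)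
      | succ q ih =>
        have := hβ i ⟨n⟩ _ (ih (i := i + 1) (by omega))
        simpa only [β, CategoryStruct.comp, Word.comp, Nat.add_comm, Nat.add_zero] using this
    | succ p ih =>
      have := hα i ⟨n⟩ _ (ih (i := i + 1) (by omega))
      simpa only [α, CategoryStruct.comp, Word.comp, Nat.add_comm, Nat.add_zero] using this

end Lam

section Lift

variable {k : ℕ → ℕ} {D : Type*} [Category D] {F : ℕ → D}

/-- The composite `A_i A_{i+1} ⋯ A_{i+p-1}`. -/
def Word.power (A : ∀ n, F n ⟶ F (n + 1)) : (p : ℕ) → {i n : ℕ} → i + p = n → (F i ⟶ F n)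
  | 0, _, _, h => eqToHom (congrArg F h)
  | p + 1, i, _, h => A i ≫ Word.power A p (by omega)

theorem Word.power_add (A : ∀ n, F n ⟶ F (n + 1)) (p p' : ℕ) {i l n : ℕ} (h : i + p = l)
    (h' : l + p' = n) :
    Word.power A p h ≫ Word.power A p' h' = Word.power A (p + p') (i := i) (by omega) := by
  induction p generalizing i with
  | zero => obtain rfl : i = l := h; simp [Word.power]
  | succ p ih =>
    obtain rfl := h
    simp only [Word.power, Category.assoc]
    rw [ih]
    have : p + 1 + p' = p + p' + 1 := by omega
    simp only [this, Word.power]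

theorem Word.power_edge {A B : ∀ n, F n ⟶ F (n + 1)}
    (hAB : ∀ n, A n ≫ B (n + 1) = B n ≫ A (n + 1)) (q : ℕ) {i l : ℕ} (h : i + q = l) :
    Word.power B q h ≫ A l = A i ≫ Word.power B q (i := i + 1) (by omega) := by
  induction q generalizing i with
  | zero => obtain rfl : i = l := h; simp [Word.power]
  | succ q ih =>
    simp only [Word.power, Category.assoc]
    rw [ih, ← Category.assoc, ← hAB, Category.assoc]

theorem Word.power_comm {A B : ∀ n, F n ⟶ F (n + 1)}
    (hAB : ∀ n, A n ≫ B (n + 1) = B n ≫ A (n + 1)) (p q : ℕ) {i l l' n : ℕ} (h : i + q = l)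
    (h' : l + p = n) (g : i + p = l') (g' : l' + q = n) :
    Word.power B q h ≫ Word.power A p h' = Word.power A p g ≫ Word.power B q g' := by
  induction p generalizing i l with
  | zero => obtain rfl : l = n := h'; obtain rfl : i = l' := g; simp [Word.power]
  | succ p ih =>
    simp only [Word.power, Category.assoc]
    rw [← Category.assoc, Word.power_edge hAB, Category.assoc, ih]

/-- The value of a word in `D`. -/
def Word.eval (A B : ∀ n, F n ⟶ F (n + 1)) (G : ∀ n, Fin (k (n + 1)) → (F n ⟶ F (n + 1))) :
    {i n : ℕ} → Word k i n → (F i ⟶ F n)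
  | _, _, .last p q h => Word.power A p rfl ≫ Word.power B q h
  | _, _, .cons p q h j w => Word.power A p rfl ≫ Word.power B q h ≫ G _ j ≫ Word.eval A B G w

theorem Word.eval_comp {A B : ∀ n, F n ⟶ F (n + 1)}
    (G : ∀ n, Fin (k (n + 1)) → (F n ⟶ F (n + 1)))
    (hAB : ∀ n, A n ≫ B (n + 1) = B n ≫ A (n + 1)) {i l n : ℕ} (w : Word k i l)
    (w' : Word k l n) :
    Word.eval A B G (w.comp w') = Word.eval A B G w ≫ Word.eval A B G w' := by
  have key : ∀ (p q p' q' : ℕ) {i l n : ℕ} (h : i + p + q = l) (h' : l + p' + q' = n),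
      (Word.power A p rfl ≫ Word.power B q h) ≫ Word.power A p' rfl ≫ Word.power B q' h' =
      Word.power A (p + p') (i := i) rfl ≫ Word.power B (q + q') (by omega) := by
    intro p q p' q' i l n h h'
    rw [← Word.power_add A p p' rfl (by omega), ← Word.power_add B q q' rfl (by omega)]
    simp only [Category.assoc]
    congr 1
    rw [← Category.assoc, Word.power_comm hAB p' q h rfl (l' := i + (p + p')) (by omega) (by omega),
      Category.assoc]
    have aux : ∀ m m' (e : m = m') (h₁ : i + (p + p') + q = m) (h₂ : m + q' = n)
        (h₁' : i + (p + p') + q = m') (h₂' : m' + q' = n),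
        Word.power B q h₁ ≫ Word.power B q' h₂ = Word.power B q h₁' ≫ Word.power B q' h₂' := by
      rintro m _ rfl _ _ _ _; rfl
    rw [aux _ _ (by omega) _ _ rfl (by omega)]
  induction w with
  | last p q h =>
    cases w' with
    | last p' q' h' => exact (key p q p' q' h h').symm
    | cons p' q' h' j w =>
      have := key p q p' q' h h'
      simp only [Word.comp, Word.eval]
      rw [← Category.assoc, ← this]
      simp only [Category.assoc]
  | cons p q h j w ih => simp only [Word.comp, Word.eval, ih, Category.assoc]

/-- The functor on `Λ` with given values on the vertices and edges. -/
def Lam.lift {A B : ∀ n, F n ⟶ F (n + 1)} (G : ∀ n, Fin (k (n + 1)) → (F n ⟶ F (n + 1)))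
    (hAB : ∀ n, A n ≫ B (n + 1) = B n ≫ A (n + 1)) : Lam k ⥤ D where
  obj a := F a.idx
  map f := Word.eval A B G f
  map_id a := by
    change Word.eval A B G (Word.last 0 0 rfl) = _
    simp [Word.eval, Word.power]
  map_comp f g := Word.eval_comp G hAB f g

theorem Lam.lift_map {A B : ∀ n, F n ⟶ F (n + 1)} (G : ∀ n, Fin (k (n + 1)) → (F n ⟶ F (n + 1)))
    (hAB : ∀ n, A n ≫ B (n + 1) = B n ≫ A (n + 1)) (n : ℕ) :
    (Lam.lift G hAB).map (Lam.α n) = A n ∧ (Lam.lift G hAB).map (Lam.β n) = B n ∧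
      ∀ j, (Lam.lift G hAB).map (Lam.γ n j) = G n j := by
  refine ⟨?_, ?_, fun j => ?_⟩
  · change Word.eval A B G (Word.last 1 0 rfl) = _
    simp [Word.eval, Word.power]
  · change Word.eval A B G (Word.last 0 1 rfl) = _
    simp [Word.eval, Word.power]
  · change Word.eval A B G (Word.cons 0 0 rfl j (Word.last 0 0 rfl)) = _
    simp [Word.eval, Word.power]

end Lift

/-! ### The groupoid `G` and the data attached to `σ` -/

/-- The vertex `v₁`. -/
abbrev Lam.v₁ (k : ℕ → ℕ) : Lam k := ⟨0⟩

/-- The unit space `X = v₁∂Λ` of the groupoid `G = G(Λ)|_X`. -/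
abbrev UnitSpace (k : ℕ → ℕ) := PathCat.boundary (Lam.v₁ k)

/-- The complement of `Z(β_1)` in the unit space of `G`. -/
def complZβ (k : ℕ → ℕ) : Set (UnitSpace k) :=
  {x | x.1 ∉ PathCat.Z (u := Lam.v₁ k) ⟨_, Lam.β 0⟩}

/-- The infinite continued fraction `[g₀, g₁, g₂, …]` with coefficients in `ℕ`. Zero coefficients are
allowed; the convergents `GenContFract.convs` are the quotients `pₙ / qₙ` given by the usual
recurrences `pₙ = gₙ pₙ₋₁ + pₙ₋₂`, `qₙ = gₙ qₙ₋₁ + qₙ₋₂`. -/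
def contFrac (g : ℕ → ℕ) : GenContFract ℝ where
  h := g 0
  s := Stream'.Seq.ofStream fun n => ⟨1, g (n + 1)⟩

/-- `σ` has the simple continued fraction expansion `[c₀, c₁, c₂, …]`. -/
structure IsSimpleExpansion (σ : ℝ) (c : ℕ → ℕ) : Prop where
  pos : ∀ i, 1 ≤ i → 0 < c i
  tendsto : Tendsto (contFrac c).convs atTop (𝓝 σ)

/-- The index `c₁ + c₃ + ⋯ + c_{2p-1} + 2`. -/
def blockIndex (c : ℕ → ℕ) (p : ℕ) : ℕ := (∑ j ∈ Finset.range p, c (2 * j + 1)) + 2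

/-- `(k_i)_{i ≥ 1} = (k₁, c₀, 0, …, 0, c₂, 0, …, 0, c₄, …)`, where `k₁` is arbitrary and the strings
of zeros have lengths `c₁ - 1`, `c₃ - 1`, …. -/
structure IsAttached (c k : ℕ → ℕ) : Prop where
  at_pos : ∀ p, k (blockIndex c p) = c (2 * p)
  between : ∀ p i, blockIndex c p < i → i < blockIndex c (p + 1) → k i = 0

/-- The coefficients of `[0, 1, k₁, 1, k₂, 1, k₃, …]`. -/
def θCoeff (k : ℕ → ℕ) (n : ℕ) : ℕ := if n = 0 then 0 else if Odd n then 1 else k (n / 2)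

/-!
Let `M_n` be the mass that an invariant probability measure gives to `Z(μ)`, for a path `μ` from
`v_{n+1}` to `v_1`; the bisection `{[μ, ν, x]}` shows that it depends on `n` only
(`Lam.bZ_eq_of_isInvariant`). On the boundary, `Z(μ)` is the union of `Z(μα)`, `Z(μβ)` and the
`Z(μγ⁽ʲ⁾)`, where only the first two sets meet, in `Z(μαβ)`. With `d_n = M_n - M_{n+1} ≥ 0` this
reads `M_n = d_n + M_{n+1}` and `d_n = k_{n+1} M_{n+1} + d_{n+1}`, which is the Euclidean
algorithm for the continued fraction of `d_0 / M_0`. As `M_0 = 1`, nonnegativity of all terms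
forces `1 - M_1 = d_0 = θ` (`eq_θLim_of_recurrence`). So all `M_n` are known, and they determine
the measure, since intersections of cylinders are cylinders or empty (`PathCat.measure_ext_bZ`).

For existence, let `M_n` (`mass`) be the solution of the recurrence with `d_0 = θ`. It tends to
`0` because infinitely many `k_i` are positive, hence the paths `α^p β^q γ` starting at a vertex
carry all of the mass (`tsum_tsum_mass`). Iterating the operation that assembles a measure at a
vertex from its translates by these paths yields measures with the right mass on every cylinder
from some stage on (`Lam.approx_bZ`), and a weak limit point exists because the boundary is
compact.

A measure with `m(Z(μ))` depending on `s(μ)` only satisfies `m(μV) = m(νV)` for all Borel sets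
`V`, and every open bisection is a countable disjoint union of sets `{[μ, ν, x] | x ∈ V}`; so it
is invariant (`Lam.isInvariant_of_bZ`). What makes the passage between cylinders and the boundary
work is the identification of the boundary with the set of infinite directed hereditary sets
(`Lam.mem_boundary_iff`).
-/

/-! ### Categories of paths with least common extensions -/

namespace PathCat

universe v u

/-- Left cancellation (for the prefix relation), and existence of a least common extension for any
two paths that have a common extension. -/
class HasJoins (C : Type u) [Category.{v} C] : Prop where
  of_pre : ∀ {u w : C} (μ : u ⟶ w) (a b : From w), IsPrefix (pre μ a) (pre μ b) → IsPrefix a b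
  exists_join : ∀ {u : C} (a b d : From u), IsPrefix a d → IsPrefix b d →
    ∃ e, IsPrefix a e ∧ IsPrefix b e ∧ ∀ d', IsPrefix a d' → IsPrefix b d' → IsPrefix e d'

variable {C : Type u} [Category.{v} C]

/-- The empty path at `u`. -/
def nil (u : C) : From u := ⟨u, 𝟙 u⟩

theorem nil_isPrefix {u : C} (a : From u) : IsPrefix (nil u) a := ⟨a.2, Category.id_comp _⟩

theorem mem_Z {u : C} {a : From u} {x : DirHer u} : x ∈ Z a ↔ a ∈ x.carrier := Iff.rfl

theorem Z_nil (u : C) : Z (nil u) = Set.univ := by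
  refine Set.eq_univ_of_forall fun x => ?_
  obtain ⟨a, ha⟩ := x.nonempty
  exact x.hereditary a ha _ (nil_isPrefix a)

theorem Z_anti {u : C} {a b : From u} (h : IsPrefix a b) : Z b ⊆ Z a :=
  fun x hx => x.hereditary b hx a h

theorem pre_nil {u w : C} (μ : u ⟶ w) : pre μ (nil w) = ⟨w, μ⟩ := by
  simp [pre, nil]

theorem isPrefix_pre {u : C} (a : From u) (b : From a.1) : IsPrefix a (pre a.2 b) := ⟨b.2, rfl⟩

theorem exists_pre_of_isPrefix {u : C} {a d : From u} (h : IsPrefix a d) :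
    ∃ b : From a.1, d = pre a.2 b := by
  obtain ⟨η, hη⟩ := h
  exact ⟨⟨d.1, η⟩, by simp [pre, hη]⟩

theorem isOpen_Z {u : C} (a : From u) : IsOpen (Z a) :=
  TopologicalSpace.isOpen_generateFrom_of_mem ⟨a, ∅, Set.finite_empty, by simp⟩

theorem isClosed_Z {u : C} (a : From u) : IsClosed (Z a) := by
  rw [← isOpen_compl_iff]
  refine TopologicalSpace.isOpen_generateFrom_of_mem ⟨nil u, {a}, Set.finite_singleton a, ?_⟩
  rw [Z_nil]
  ext x
  simp

instance (u : C) : T2Space (DirHer u) where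
  t2 := by
    intro x y hxy
    have : ∃ a, ¬ (a ∈ x.carrier ↔ a ∈ y.carrier) := by
      by_contra! h
      exact hxy (DirHer.ext (Set.ext h))
    obtain ⟨a, ha⟩ := this
    by_cases hx : a ∈ x.carrier
    · exact ⟨Z a, (Z a)ᶜ, isOpen_Z a, (isClosed_Z a).isOpen_compl, hx,
        fun h => ha (by simp_all [Z]),
        disjoint_compl_right⟩
    · exact ⟨(Z a)ᶜ, Z a, (isClosed_Z a).isOpen_compl, isOpen_Z a, hx, by
        by_contra h
        exact ha (by simp_all [Z]), disjoint_compl_left⟩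

/-- The trace of the cylinder `Z(a)` on the boundary. -/
def bZ {u : C} (a : From u) : Set (boundary u) := Subtype.val ⁻¹' Z a

theorem measurableSet_bZ {u : C} (a : From u) : MeasurableSet (bZ a) :=
  (isOpen_Z a).measurableSet.preimage measurable_subtype_coe

section HasJoins

variable [HasJoins C]

/-- Two cylinders are disjoint, or intersect in a cylinder. -/
theorem Z_inter_Z {u : C} (a b : From u) :
    Z a ∩ Z b = ∅ ∨ ∃ e, IsPrefix a e ∧ IsPrefix b e ∧ Z a ∩ Z b = Z e := by
  rcases Set.eq_empty_or_nonempty (Z a ∩ Z b) with h | ⟨x, hxa, hxb⟩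
  · exact Or.inl h
  · obtain ⟨d, hd, had, hbd⟩ := x.directed a hxa b hxb
    obtain ⟨e, hae, hbe, he⟩ := HasJoins.exists_join a b d had hbd
    refine Or.inr ⟨e, hae, hbe, Set.Subset.antisymm ?_ ?_⟩
    · rintro y ⟨hya, hyb⟩
      obtain ⟨d', hd', h1, h2⟩ := y.directed a hya b hyb
      exact y.hereditary d' hd' e (he d' h1 h2)
    · exact fun y hy => ⟨Z_anti hae hy, Z_anti hbe hy⟩

theorem isTopologicalBasis (u : C) : TopologicalSpace.IsTopologicalBasis
    {U : Set (DirHer u) |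
      ∃ (a : From u) (F : Set (From u)), F.Finite ∧ U = Z a \ ⋃ b ∈ F, Z b} where
  exists_subset_inter := by
    rintro _ ⟨a, F, hF, rfl⟩ _ ⟨a', F', hF', rfl⟩ x ⟨⟨hxa, hxF⟩, hxa', hxF'⟩
    rcases Z_inter_Z a a' with h | ⟨e, -, -, he⟩
    · exact absurd (h ▸ ⟨hxa, hxa'⟩ : x ∈ (∅ : Set (DirHer u))) (Set.notMem_empty x)
    · refine ⟨_, ⟨e, F ∪ F', hF.union hF', rfl⟩, ⟨he ▸ ⟨hxa, hxa'⟩, ?_⟩, ?_⟩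
      · rw [Set.biUnion_union]
        exact fun h => h.elim hxF hxF'
      · rintro y ⟨hye, hyF⟩
        rw [← he] at hye
        rw [Set.biUnion_union] at hyF
        exact ⟨⟨hye.1, fun h => hyF (Or.inl h)⟩, hye.2, fun h => hyF (Or.inr h)⟩
  sUnion_eq := Set.eq_univ_of_forall fun x => ⟨Set.univ, ⟨nil u, ∅, Set.finite_empty, by
    simp [Z_nil]⟩, trivial⟩
  eq_generateFrom := rfl

/-- An ultrafilter `U` on `uΛ*` converges to the directed hereditary set `{a | Z a ∈ U}`, which is
directed because intersections of cylinders are cylinders. -/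
instance (u : C) : CompactSpace (DirHer u) where
  isCompact_univ := by
    rw [isCompact_iff_ultrafilter_le_nhds]
    intro U _
    refine ⟨⟨{a | Z a ∈ U}, ⟨nil u, by simp only [Set.mem_ofPred_eq, Z_nil]; exact univ_mem⟩,
      ?_, ?_⟩, trivial, ?_⟩
    · intro a ha b hb
      rcases Z_inter_Z a b with h | ⟨e, hae, hbe, he⟩
      · exact absurd (h ▸ inter_mem ha hb) U.empty_notMem
      · exact ⟨e, by
          simp only [Set.mem_ofPred_eq, ← he]
          exact inter_mem ha hb, hae, hbe⟩
    · exact fun a ha b hba => mem_of_superset ha (Z_anti hba)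
    · rw [TopologicalSpace.nhds_generateFrom]
      refine le_iInf₂ fun s hs => ?_
      obtain ⟨hxs, a, F, hF, rfl⟩ := hs
      rw [le_principal_iff, Set.sdiff_eq, Set.compl_iUnion₂]
      refine inter_mem hxs.1 ((biInter_mem hF).2 fun b hb => ?_)
      refine Ultrafilter.compl_mem_iff_notMem.2 fun h => hxs.2 (Set.mem_biUnion hb h)

section Countable

variable [∀ u : C, Countable (From u)]

instance (u : C) : SecondCountableTopology (DirHer u) := by
  refine (isTopologicalBasis u).secondCountableTopology ?_
  have : Set.Countable (Set.range fun p : From u × {F : Set (From u) // F.Finite} =>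
      Z p.1 \ ⋃ b ∈ p.2.1, Z b) := by
    have : Countable {F : Set (From u) // F.Finite} := 
      (Set.Countable.ofPred_finite (α := From u)).to_subtype
    exact Set.countable_range _
  refine this.mono ?_
  rintro _ ⟨a, F, hF, rfl⟩
  exact ⟨(a, ⟨F, hF⟩), rfl⟩

theorem measurableSpace_eq_generateFrom_Z (u : C) :
    (inferInstance : MeasurableSpace (DirHer u)) = MeasurableSpace.generateFrom (Set.range Z) := by
  refine le_antisymm ?_ (MeasurableSpace.generateFrom_le ?_)
  · change borel _ ≤ _
    rw [(isTopologicalBasis u).borel_eq_generateFrom]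
    refine MeasurableSpace.generateFrom_le ?_
    rintro _ ⟨a, F, hF, rfl⟩
    have hm : ∀ b : From u, MeasurableSet[MeasurableSpace.generateFrom (Set.range Z)] (Z b) :=
      fun b => MeasurableSpace.measurableSet_generateFrom ⟨b, rfl⟩
    exact (hm a).diff (MeasurableSet.biUnion hF.countable fun b _ => hm b)
  · rintro _ ⟨a, rfl⟩
    exact (isOpen_Z a).measurableSet

/-- A finite measure on the boundary is determined by its values on cylinders. -/
theorem measure_ext_bZ {u : C} {m m' : Measure (boundary u)} [IsFiniteMeasure m]
    (h : ∀ a, m (bZ a) = m' (bZ a)) : m = m' := by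
  refine ext_of_generate_finite (Set.range bZ) ?_ ?_ ?_ ?_
  · have h1 : instMeasurableSpaceDirHer u = _ := measurableSpace_eq_generateFrom_Z u
    change MeasurableSpace.comap _ _ = _
    rw [h1, MeasurableSpace.comap_generateFrom, ← Set.range_comp]
    rfl
  · rintro _ ⟨a, rfl⟩ _ ⟨b, rfl⟩ hne
    rcases Z_inter_Z a b with h | ⟨e, -, -, he⟩
    · obtain ⟨x, hx⟩ := hne
      exact absurd (h ▸ hx : x.1 ∈ (∅ : Set (DirHer u))) (Set.notMem_empty _)
    · exact ⟨e, by simp only [bZ]; rw [← Set.preimage_inter, he]⟩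
  · rintro _ ⟨a, rfl⟩
    exact h a
  · simpa [bZ, Z_nil] using h (nil u)

end Countable

/-! ### The action of paths on directed hereditary sets -/

theorem pre_mem_act {u w : C} (μ : u ⟶ w) (x : DirHer w) (a : From w) :
    pre μ a ∈ (act μ x).carrier ↔ a ∈ x.carrier :=
  ⟨fun ⟨b, hb, h⟩ => x.hereditary b hb a (HasJoins.of_pre μ a b h),
    fun h => ⟨a, h, IsPrefix.refl _⟩⟩

theorem act_injective {u w : C} (μ : u ⟶ w) : Function.Injective (act μ) := by
  intro x y h
  ext a
  rw [← pre_mem_act μ, h, pre_mem_act]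

theorem range_act {u w : C} (μ : u ⟶ w) : Set.range (act μ) = Z ⟨w, μ⟩ := by
  ext x
  constructor
  · rintro ⟨y, rfl⟩
    have := (pre_mem_act μ y (nil w)).2 (by rw [← mem_Z, Z_nil]; trivial)
    rwa [pre_nil] at this
  · intro hx
    refine ⟨⟨{a | pre μ a ∈ x.carrier}, ⟨nil w, by rw [Set.mem_ofPred_eq, pre_nil]; exact hx⟩,
      ?_, ?_⟩, ?_⟩
    · intro a ha b hb
      obtain ⟨d, hd, h1, h2⟩ := x.directed _ ha _ hb
      obtain ⟨e, rfl⟩ : ∃ e : From w, d = pre μ e :=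
        exists_pre_of_isPrefix ((isPrefix_pre ⟨w, μ⟩ a).trans h1)
      exact ⟨e, hd, HasJoins.of_pre μ _ _ h1, HasJoins.of_pre μ _ _ h2⟩
    · exact fun a ha b hb => x.hereditary _ ha _ (hb.pre μ)
    · ext a
      constructor
      · rintro ⟨b, hb, hab⟩
        exact x.hereditary _ hb _ hab
      · intro ha
        obtain ⟨d, hd, h1, h2⟩ := x.directed _ hx _ ha
        obtain ⟨e, rfl⟩ := exists_pre_of_isPrefix h1
        exact ⟨e, hd, h2⟩

theorem act_image_Z {u w : C} (μ : u ⟶ w) (a : From w) : act μ '' Z a = Z (pre μ a) := by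
  ext x
  constructor
  · rintro ⟨y, hy, rfl⟩
    exact (pre_mem_act μ y a).2 hy
  · intro hx
    obtain ⟨y, rfl⟩ : x ∈ Set.range (act μ) := by
      rw [range_act]
      exact Z_anti (isPrefix_pre ⟨w, μ⟩ a) hx
    exact ⟨y, (pre_mem_act μ y a).1 hx, rfl⟩

theorem act_preimage_Z_pre {u w : C} (μ : u ⟶ w) (a : From w) : act μ ⁻¹' Z (pre μ a) = Z a := by
  rw [← act_image_Z, Set.preimage_image_eq _ (act_injective μ)]

/-- The preimage of a cylinder under the action of a path is empty or a cylinder. -/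
theorem act_preimage_Z {u w : C} (μ : u ⟶ w) (a : From u) :
    act μ ⁻¹' Z a = ∅ ∨ ∃ b, act μ ⁻¹' Z a = Z b := by
  have h : act μ ⁻¹' Z a = act μ ⁻¹' (Z ⟨w, μ⟩ ∩ Z a) := by
    rw [Set.preimage_inter, ← range_act μ, Set.preimage_range, Set.univ_inter]
  rw [h]
  rcases Z_inter_Z ⟨w, μ⟩ a with h | ⟨e, he, -, h⟩
  · left; rw [h, Set.preimage_empty]
  · right
    obtain ⟨b, rfl⟩ := exists_pre_of_isPrefix he
    exact ⟨b, by rw [h, act_preimage_Z_pre]⟩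

theorem continuous_act {u w : C} (μ : u ⟶ w) : Continuous (act μ) := by
  have hZ : ∀ a, IsClopen (act μ ⁻¹' Z a) := by
    intro a
    rcases act_preimage_Z μ a with h | ⟨b, h⟩
    · rw [h]; exact isClopen_empty
    · rw [h]; exact ⟨isClosed_Z b, isOpen_Z b⟩
  refine continuous_generateFrom_iff.2 ?_
  rintro _ ⟨a, F, hF, rfl⟩
  rw [Set.preimage_sdiff, Set.preimage_iUnion₂]
  exact (hZ a).2.sdiff (hF.isClosed_biUnion fun b _ => (hZ b).1)

theorem isOpenMap_act {u w : C} (μ : u ⟶ w) : IsOpenMap (act μ) := by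
  rw [(isTopologicalBasis w).isOpenMap_iff]
  rintro _ ⟨a, F, hF, rfl⟩
  rw [Set.image_sdiff (act_injective μ), Set.image_iUnion₂, act_image_Z]
  simp only [act_image_Z]
  exact (isOpen_Z _).sdiff (hF.isClosed_biUnion fun b _ => isClosed_Z _)

/-! ### The arrows of the groupoid -/

/-- The sets `{x | [μ, ν, x] ∈ B}`, for `B` basic open, are open: having a neighbourhood of `x` on
which `[μ, ν, ·]` takes values in `B` is a property of the arrow `[μ, ν, x]`, since the relation
between triples moves the points by maps that are continuous and open. -/
theorem continuous_mk {u w : C} (μ ν : u ⟶ w) : Continuous (Arrows.mk μ ν) := by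
  refine continuous_generateFrom_iff.2 ?_
  rintro B ⟨w', μ', ν', E, -, hE, rfl⟩
  set B := Arrows.mk μ' ν' '' E with hB
  let P : Triple u → Prop := fun t =>
    ∃ O ∈ 𝓝 t.pt, ∀ x ∈ O, Arrows.mk t.fst t.snd x ∈ B
  have hP : ∀ t t' : Triple u, Triple.Rel t t' → P t = P t' := by
    rintro _ _ ⟨μ, ν, η, x⟩
    have key : ∀ x, Arrows.mk μ ν (act η x) = Arrows.mk (μ ≫ η) (ν ≫ η) x :=
      fun x => Quot.sound (Triple.Rel.step μ ν η x)
    refine propext ⟨?_, ?_⟩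
    · rintro ⟨O, hO, h⟩
      exact ⟨act η ⁻¹' O, (continuous_act η).continuousAt hO, fun y hy => key y ▸ h _ hy⟩
    · rintro ⟨O, hO, h⟩
      refine ⟨act η '' O, (isOpenMap_act η).image_mem_nhds hO, ?_⟩
      rintro _ ⟨y, hy, rfl⟩
      exact (key y).symm ▸ h y hy
  have hQ : ∀ x ∈ E, Quot.lift P hP (Arrows.mk μ' ν' x) := fun x hx =>
    ⟨E, hE.mem_nhds hx, fun y hy => ⟨y, hy, rfl⟩⟩
  rw [isOpen_iff_mem_nhds]
  rintro x ⟨y, hy, hxy⟩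
  obtain ⟨O, hO, h⟩ : P ⟨w, μ, ν, x⟩ := by
    have := hQ y hy
    rw [hxy] at this
    exact this
  exact mem_of_superset hO h

theorem isOpen_range_mk {u w : C} (μ ν : u ⟶ w) : IsOpen (Set.range (Arrows.mk μ ν)) :=
  TopologicalSpace.isOpen_generateFrom_of_mem
    ⟨w, μ, ν, Set.univ, isCompact_univ, isOpen_univ, Set.image_univ.symm⟩

end HasJoins

end PathCat

/-! ### Prefixes of words -/

namespace Word

variable {k : ℕ → ℕ}

theorem le {i n : ℕ} (w : Word k i n) : i ≤ n := by
  induction w <;> omega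

/-- `w` is a prefix of `w'`. -/
def Le {i n n' : ℕ} (w : Word k i n) (w' : Word k i n') : Prop := ∃ η : Word k n n', w.comp η = w'

theorem Le.le {i n n' : ℕ} {w : Word k i n} {w' : Word k i n'} (h : w.Le w') : n ≤ n' :=
  h.choose.le

theorem last_le_last {i n n' p q p' q' : ℕ} {h : i + p + q = n} {h' : i + p' + q' = n'} :
    Le (last (k := k) p q h) (last p' q' h') ↔ p ≤ p' ∧ q ≤ q' := by
  constructor
  · rintro ⟨η, hη⟩
    cases η with
    | last a b e =>
      simp only [comp, last.injEq] at hη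
      omega
    | cons => simp [comp] at hη
  · rintro ⟨h1, h2⟩
    refine ⟨last (p' - p) (q' - q) (by omega), ?_⟩
    simp only [comp, last.injEq]
    omega

theorem last_le_cons {i n n' p q p' q' l : ℕ} {h : i + p + q = n} {h' : i + p' + q' = l}
    {j : Fin (k (l + 1))} {w : Word k (l + 1) n'} :
    Le (last (k := k) p q h) (cons p' q' h' j w) ↔ p ≤ p' ∧ q ≤ q' := by
  constructor
  · rintro ⟨η, hη⟩
    cases η with
    | last => simp [comp] at hη
    | cons a b e j' w' =>
      simp only [comp] at hη
      injection hη
      omega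
  · rintro ⟨h1, h2⟩
    refine ⟨cons (p' - p) (q' - q) (by omega) j w, ?_⟩
    simp only [comp]
    congr 1 <;> omega

theorem cons_le_cons {i n n' p q l : ℕ} {h : i + p + q = l}
    {j : Fin (k (l + 1))} {w : Word k (l + 1) n} {w' : Word k (l + 1) n'} :
    Le (cons p q h j w) (cons p q h j w') ↔ w.Le w' := by
  constructor
  · rintro ⟨η, hη⟩
    simp only [comp, cons.injEq, heq_eq_eq, true_and] at hη
    exact ⟨η, hη⟩
  · rintro ⟨η, rfl⟩
    exact ⟨η, rfl⟩

theorem eq_cons_of_cons_le {i n n' p q l : ℕ} {h : i + p + q = l}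
    {j : Fin (k (l + 1))} {w : Word k (l + 1) n} {z : Word k i n'} (hz : Le (cons p q h j w) z) :
    ∃ z' : Word k (l + 1) n', z = cons p q h j z' ∧ w.Le z' := by
  obtain ⟨η, rfl⟩ := hz
  exact ⟨w.comp η, rfl, η, rfl⟩

theorem le_refl {i n : ℕ} (w : Word k i n) : w.Le w := ⟨_, comp_id w⟩

/-- Words with a common extension have a least one. -/
theorem exists_join {i n n' m : ℕ} (w : Word k i n) (w' : Word k i n') (z : Word k i m)
    (hw : w.Le z) (hw' : w'.Le z) : ∃ (s : ℕ) (e : Word k i s), w.Le e ∧ w'.Le e ∧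
      ∀ (m' : ℕ) (z' : Word k i m'), w.Le z' → w'.Le z' → e.Le z' := by
  induction w generalizing n' m with
  | last p q h =>
    cases w' with
    | last p' q' h' =>
      refine ⟨_, last (max p p') (max q q') rfl, last_le_last.2 (by omega),
        last_le_last.2 (by omega), fun m' z' h1 h2 => ?_⟩
      cases z' with
      | last =>
        rw [last_le_last] at *
        omega
      | cons =>
        rw [last_le_cons] at *
        omega
    | cons p' q' h' j v =>
      obtain ⟨z', rfl, -⟩ := eq_cons_of_cons_le hw'
      exact ⟨_, _, last_le_cons.2 (last_le_cons.1 hw), le_refl _, fun _ _ _ h => h⟩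
  | cons p q h j v ih =>
    obtain ⟨z', rfl, hz'⟩ := eq_cons_of_cons_le hw
    cases w' with
    | last p' q' h' =>
      exact ⟨_, _, le_refl _, last_le_cons.2 (last_le_cons.1 hw'), fun _ _ h _ => h⟩
    | cons p' q' h' j' v' =>
      obtain ⟨z'', hz, hz''⟩ := eq_cons_of_cons_le hw'
      rw [cons.injEq] at hz
      obtain ⟨rfl, rfl, rfl, e5, e6⟩ := hz
      obtain rfl := eq_of_heq e5
      obtain rfl := eq_of_heq e6
      obtain ⟨s, e, h1, h2, h3⟩ := ih v' z' hz' hz''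
      refine ⟨s, cons _ _ h _ e, cons_le_cons.2 h1, cons_le_cons.2 h2, fun m' z0 h4 h5 => ?_⟩
      obtain ⟨y, rfl, hy⟩ := eq_cons_of_cons_le h4
      exact cons_le_cons.2 (h3 _ _ hy (cons_le_cons.1 h5))

theorem comp_left_cancel {i l n : ℕ} (w : Word k i l) (a b : Word k l n) (h : w.comp a = w.comp b) :
    a = b := by
  induction w with
  | last p q h' =>
    cases a <;> cases b <;> simp only [comp, last.injEq, cons.injEq, reduceCtorEq] at h
    · congr 1 <;> omega
    · obtain ⟨rfl, h1, h2, h3, h4⟩ := h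
      obtain rfl := eq_of_heq h3
      obtain rfl := eq_of_heq h4
      congr 1 <;> omega
  | cons p q h' j w ih =>
    simp only [comp, cons.injEq, heq_eq_eq, true_and] at h
    exact ih a b h

instance {i n : ℕ} : Countable (Word k i n) := by
  let S := Σ l : ℕ, Fin (k (l + 1))
  -- a word is determined by the list of its blocks `α^p β^q γ` and its last exponents
  let code : ∀ {i n : ℕ}, Word k i n → List (ℕ × ℕ × S) × ℕ × ℕ := fun w =>
    Word.rec (motive := fun _ _ _ => List (ℕ × ℕ × S) × ℕ × ℕ)
      (fun p q _ => ([], p, q)) (fun p q _ j _ c => ((p, q, ⟨_, j⟩) :: c.1, c.2)) w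
  have : Function.Injective (code : Word k i n → _) := by
    intro w w' h
    induction w with
    | last p q h1 =>
      cases w' <;> simp [code] at h
      obtain ⟨rfl, rfl⟩ := h
      rfl
    | cons p q h1 j w ih =>
      cases w' with
      | last => simp [code] at h
      | cons p' q' h2 j' w' =>
        simp only [code, Prod.mk.injEq, List.cons.injEq, Sigma.mk.injEq, S] at h
        obtain ⟨⟨⟨rfl, rfl, rfl, h3⟩, h4⟩, h5⟩ := h
        obtain rfl := eq_of_heq h3
        rw [ih (Prod.ext h4 h5)]
  exact this.countable

/-- Edges `γ` are free: every prefix of `wγη` that is not longer than `w` is a prefix of `w`. -/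
theorem le_of_le_γ {i l n m : ℕ} (w : Word k i l) (b : Word k i n) (hn : n ≤ l)
    (j : Fin (k (l + 1))) (η : Word k (l + 1) m)
    (h : b.Le (w.comp (cons 0 0 rfl j η))) : b.Le w := by
  induction w generalizing n with
  | last p q h' =>
    cases b with
    | last =>
      rw [comp, last_le_cons] at h
      rw [last_le_last]
      exact h
    | cons p' q' h'' j' v =>
      exfalso
      obtain ⟨z, hz, -⟩ := eq_cons_of_cons_le h
      rw [comp] at hz
      rw [cons.injEq] at hz
      have := v.le
      omega
  | cons p q h' j' w ih =>
    cases b with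
    | last => exact last_le_cons.2 (last_le_cons.1 h)
    | cons p' q' h'' j'' v =>
      obtain ⟨z, hz, hz'⟩ := eq_cons_of_cons_le h
      rw [comp] at hz
      rw [cons.injEq] at hz
      obtain ⟨rfl, rfl, rfl, e5, e6⟩ := hz
      obtain rfl := eq_of_heq e5
      obtain rfl := eq_of_heq e6
      exact cons_le_cons.2 (ih v hn j η hz')

end Word

namespace Lam

open PathCat

variable {k : ℕ → ℕ}

/-- The path in `v_{i+1}Λ` given by a word. -/
def path {i n : ℕ} (w : Word k i n) : From (⟨i⟩ : Lam k) := ⟨⟨n⟩, w⟩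

theorem isPrefix_path {i n n' : ℕ} {w : Word k i n} {w' : Word k i n'} :
    IsPrefix (path w) (path w') ↔ w.Le w' := Iff.rfl

instance : HasJoins (Lam k) where
  of_pre := by
    rintro ⟨i⟩ ⟨l⟩ μ ⟨⟨n⟩, a⟩ ⟨⟨n'⟩, b⟩ ⟨η, hη⟩
    refine ⟨η, Word.comp_left_cancel μ _ _ ?_⟩
    exact (Word.assoc μ a η).symm.trans hη
  exists_join := by
    rintro ⟨i⟩ ⟨⟨n⟩, a⟩ ⟨⟨n'⟩, b⟩ ⟨⟨m⟩, d⟩ h1 h2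
    obtain ⟨s, e, h3, h4, h5⟩ := Word.exists_join a b d h1 h2
    exact ⟨⟨⟨s⟩, e⟩, h3, h4, fun d' h h' => h5 _ d'.2 h h'⟩

instance : Countable (Lam k) :=
  (show Function.Injective (Lam.idx (k := k)) by
    rintro ⟨i⟩ ⟨j⟩ h; simpa using h).countable

instance (u w : Lam k) : Countable (u ⟶ w) :=
  inferInstanceAs (Countable (Word k u.idx w.idx))

instance (u : Lam k) : Countable (From u) :=
  inferInstanceAs (Countable (Σ w : Lam k, (u ⟶ w)))

end Lam

/-! ### Maximal directed hereditary sets -/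

namespace PathCat

universe v u

variable {C : Type u} [Category.{v} C]

/-- The set of all prefixes of a path. -/
def principal {u : C} (a : From u) : DirHer u where
  carrier := {b | IsPrefix b a}
  nonempty := ⟨a, IsPrefix.refl a⟩
  directed := fun _ hb _ hc => ⟨a, IsPrefix.refl a, hb, hc⟩
  hereditary := fun _ hb _ hc => hc.trans hb

/-- Every directed hereditary set is contained in a maximal one, by Zorn's lemma. -/
theorem exists_maximal {u : C} (x : DirHer u) : ∃ y : DirHer u, x.carrier ⊆ y.carrier ∧
    ∀ z : DirHer u, y.carrier ⊆ z.carrier → z.carrier ⊆ y.carrier := by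
  obtain ⟨m, hxm, ⟨y, rfl⟩, hm⟩ := zorn_subset_nonempty (Set.range (DirHer.carrier (u := u))) (by
    intro c hc hchain ⟨s, hs⟩
    refine ⟨⋃₀ c, ⟨⟨⋃₀ c, ?_, ?_, ?_⟩, rfl⟩, fun s hs => Set.subset_sUnion_of_mem hs⟩
    · obtain ⟨x, rfl⟩ := hc hs
      obtain ⟨a, ha⟩ := x.nonempty
      exact ⟨a, _, hs, ha⟩
    · rintro a ⟨s, hs, ha⟩ b ⟨t, ht, hb⟩
      obtain ⟨r, hr, har, hbr⟩ : ∃ r ∈ c, a ∈ r ∧ b ∈ r := by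
        rcases hchain.total hs ht with h | h
        · exact ⟨t, ht, h ha, hb⟩
        · exact ⟨s, hs, ha, h hb⟩
      obtain ⟨x, rfl⟩ := hc hr
      obtain ⟨d, hd, h⟩ := x.directed a har b hbr
      exact ⟨d, ⟨_, hr, hd⟩, h⟩
    · rintro a ⟨s, hs, ha⟩ b hb
      obtain ⟨x, rfl⟩ := hc hs
      exact ⟨_, hs, x.hereditary a ha b hb⟩) x.carrier ⟨x, rfl⟩
  exact ⟨y, hxm, fun z hz => hm ⟨z, rfl⟩ hz⟩

end PathCat

/-! ### The boundary of `Λ` -/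

namespace Word

variable {k : ℕ → ℕ}

/-- A word has prefixes of all smaller lengths. -/
theorem exists_le {i m : ℕ} (w : Word k i m) {n : ℕ} (hi : i ≤ n) (hm : n ≤ m) :
    ∃ v : Word k i n, v.Le w := by
  induction w with
  | @last i _ p q h =>
    exact ⟨last (min p (n - i)) (n - i - min p (n - i)) (by omega), last_le_last.2 (by omega)⟩
  | @cons i l _ p q h j w ih =>
    by_cases hl : n ≤ l
    · exact ⟨last (min p (n - i)) (n - i - min p (n - i)) (by omega), last_le_cons.2 (by omega)⟩
    · obtain ⟨v, hv⟩ := ih (by omega) hm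
      exact ⟨cons p q h j v, cons_le_cons.2 hv⟩

theorem eq_of_length_one {i : ℕ} (w : Word k i (i + 1)) : w = last 1 0 rfl ∨ w = last 0 1 rfl ∨
    ∃ j, w = cons 0 0 rfl j (last 0 0 rfl) := by
  cases w with
  | last p q h =>
    have : p = 1 ∧ q = 0 ∨ p = 0 ∧ q = 1 := by omega
    rcases this with ⟨rfl, rfl⟩ | ⟨rfl, rfl⟩ <;> simp
  | cons p q h j w =>
    have := w.le
    obtain rfl : p = 0 := by omega
    obtain rfl : q = 0 := by omega
    obtain rfl := h
    refine Or.inr (Or.inr ⟨j, ?_⟩)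
    cases w with
    | last p q h =>
      obtain rfl : p = 0 := by omega
      obtain rfl : q = 0 := by omega
      rfl
    | cons p q h j w =>
      have := w.le
      omega

theorem comp_γ_comp {i l m : ℕ} (v : Word k i l) (j : Fin (k (l + 1))) (ζ : Word k (l + 1) m) :
    (v.comp (cons 0 0 rfl j (last 0 0 rfl))).comp ζ = v.comp (cons 0 0 rfl j ζ) := by
  rw [assoc, comp, id_comp]

theorem αβ_le {i n : ℕ} {d : Word k i n} (h : Le (last 1 0 rfl) d) (h' : Le (last 0 1 rfl) d) :
    Le (last 1 1 rfl) d := by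
  cases d with
  | last =>
    rw [last_le_last] at *
    omega
  | cons =>
    rw [last_le_cons] at *
    omega

theorem eq_last_of_self {i : ℕ} (w : Word k i i) : w = last 0 0 rfl := by
  cases w with
  | last p q h =>
    obtain rfl : p = 0 := by omega
    obtain rfl : q = 0 := by omega
    rfl
  | cons p q h j w =>
    have := w.le
    omega

end Word

namespace Lam

open PathCat

variable {k : ℕ → ℕ}

theorem idx_le_of_isPrefix {u : Lam k} {a b : From u} (h : IsPrefix a b) : a.1.idx ≤ b.1.idx :=
  Word.le h.choose

/-- The prefix of length one of a proper extension of `a`. -/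
theorem exists_edge_isPrefix {u : Lam k} {a d : From u} (h : IsPrefix a d)
    (hd : a.1.idx < d.1.idx) :
    IsPrefix (pre a.2 (path (Word.last 1 0 rfl))) d ∨
    IsPrefix (pre a.2 (path (Word.last 0 1 rfl))) d ∨
    ∃ j, IsPrefix (pre a.2 (path (Word.cons 0 0 rfl j (Word.last 0 0 rfl)))) d := by
  obtain ⟨η, rfl⟩ := exists_pre_of_isPrefix h
  obtain ⟨v, hv⟩ := Word.exists_le η.2 (Nat.le_succ a.1.idx) hd
  have hv' : IsPrefix (pre a.2 (path v)) (pre a.2 η) :=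
    IsPrefix.pre a.2 (a := path v) (b := η) hv
  rcases Word.eq_of_length_one v with rfl | rfl | ⟨j, rfl⟩
  · exact Or.inl hv'
  · exact Or.inr (Or.inl hv')
  · exact Or.inr (Or.inr ⟨j, hv'⟩)

theorem isPrefix_of_idx_le {u : Lam k} {a d : From u} (h : IsPrefix a d)
    (hd : d.1.idx ≤ a.1.idx) : IsPrefix d a := by
  obtain ⟨w, a⟩ := a
  obtain ⟨⟨n⟩, d⟩ := d
  obtain ⟨η, hη⟩ := h
  obtain ⟨l⟩ := w
  have : l ≤ n := Word.le η
  obtain rfl : l = n := le_antisymm this hd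
  have : η = 𝟙 (⟨l⟩ : Lam k) := Word.eq_last_of_self η
  subst this
  have h : a ≫ 𝟙 (⟨l⟩ : Lam k) = d := hη
  rw [Category.comp_id] at h
  subst h
  exact IsPrefix.refl _

/-- The boundary consists of the infinite directed hereditary sets: the finite ones are isolated
and not maximal, and an infinite `x` is the limit of maximal sets containing `dγ`, for paths `d` of
`x` after which an edge `γ` is available. -/
theorem mem_boundary_iff (hk : ∀ N, ∃ n ≥ N, 0 < k (n + 1)) {u : Lam k} {x : DirHer u} :
    x ∈ boundary u ↔ ∀ N, ∃ a ∈ x.carrier, N ≤ a.1.idx := by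
  constructor
  · intro hx
    by_contra! hN
    obtain ⟨N, hN⟩ := hN
    obtain ⟨a, ha, hmax⟩ : ∃ a ∈ x.carrier, ∀ b ∈ x.carrier, b.1.idx ≤ a.1.idx := by
      have hfin : ((fun a : From u => a.1.idx) '' x.carrier).Finite :=
        (Set.finite_lt_nat N).subset (by rintro _ ⟨a, ha, rfl⟩; exact hN a ha)
      obtain ⟨_, ⟨a, ha, rfl⟩, h⟩ := Set.exists_max_image _ id hfin (x.nonempty.image _)
      exact ⟨a, ha, fun b hb => h _ ⟨b, hb, rfl⟩⟩
    -- `O` contains `x`, and every member of `O` is contained in the set of prefixes of `a`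
    let O : Set (DirHer u) := Z a \ (Z (pre a.2 (path (Word.last 1 0 rfl))) ∪
      (Z (pre a.2 (path (Word.last 0 1 rfl))) ∪
        ⋃ j, Z (pre a.2 (path (Word.cons 0 0 rfl j (Word.last 0 0 rfl))))))
    have hO : IsOpen O := (isOpen_Z a).sdiff ((isClosed_Z _).union ((isClosed_Z _).union
      (isClosed_iUnion_of_finite fun j => isClosed_Z _)))
    have hxO : x ∈ O := by
      have hout : ∀ {w : Word k a.1.idx (a.1.idx + 1)}, pre a.2 (path w) ∉ x.carrier :=
        fun h => absurd (hmax _ h) (by simp [pre, path])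
      refine ⟨ha, ?_⟩
      rintro (h | h | h)
      · exact hout h
      · exact hout h
      · obtain ⟨j, h⟩ := Set.mem_iUnion.1 h
        exact hout h
    obtain ⟨y, ⟨hya, hyO⟩, hy⟩ := mem_closure_iff.1 hx O hO hxO
    have hpre : ∀ b ∈ y.carrier, IsPrefix b a := by
      intro b hb
      obtain ⟨d, hd, had, hbd⟩ := y.directed a hya b hb
      rcases lt_or_ge a.1.idx d.1.idx with h | h
      · exfalso
        rcases exists_edge_isPrefix had h with h | h | ⟨j, h⟩
        · exact hyO (Or.inl (y.hereditary _ hd _ h))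
        · exact hyO (Or.inr (Or.inl (y.hereditary _ hd _ h)))
        · exact hyO (Or.inr (Or.inr (Set.mem_iUnion.2 ⟨j, y.hereditary _ hd _ h⟩)))
      · exact hbd.trans (isPrefix_of_idx_le had h)
    -- `y` would be properly contained in the set of prefixes of `aα`
    have := hy (principal (pre a.2 (path (Word.last 1 0 rfl))))
      (fun b hb => (hpre b hb).trans (isPrefix_pre a _)) (IsPrefix.refl _)
    exact hyO (Or.inl this)
  · intro hx
    refine (isTopologicalBasis u).mem_closure_iff.2 ?_
    rintro _ ⟨a, F, hF, rfl⟩ ⟨hxa, hxF⟩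
    obtain ⟨N, hN⟩ : ∃ N, ∀ b ∈ F, b.1.idx ≤ N := by
      obtain ⟨N, hN⟩ := (hF.image fun b : From u => b.1.idx).bddAbove
      exact ⟨N, fun b hb => hN ⟨b, hb, rfl⟩⟩
    -- a maximal set containing `avγ`, with `av` in `x` at least as long as all paths of `F`, cannot
    -- contain an element of `F`, which would be a prefix of `av`
    obtain ⟨n, hn, hkn⟩ := hk (max N a.1.idx)
    obtain ⟨b, hb, hbn⟩ := hx n
    obtain ⟨d, hd, had, hbd⟩ := x.directed a hxa b hb
    obtain ⟨η, rfl⟩ := exists_pre_of_isPrefix had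
    obtain ⟨v, hv⟩ := Word.exists_le η.2 (le_trans (le_max_right _ _) hn)
      (hbn.trans (idx_le_of_isPrefix hbd))
    have hvx : pre a.2 (path v) ∈ x.carrier :=
      x.hereditary _ hd _ (IsPrefix.pre a.2 (a := path v) (b := η) hv)
    let e : From u := pre a.2 (path (v.comp (Word.cons 0 0 rfl ⟨0, hkn⟩ (Word.last 0 0 rfl))))
    obtain ⟨y, hey, hy⟩ := exists_maximal (principal e)
    have hye : e ∈ y.carrier := hey (IsPrefix.refl e)
    refine ⟨y, ⟨y.hereditary _ hye _ (isPrefix_pre a _), ?_⟩, hy⟩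
    simp only [Set.mem_iUnion, not_exists]
    intro f hf hyf
    obtain ⟨d', hd', hed', hfd'⟩ := y.directed e hye f hyf
    refine hxF (Set.mem_biUnion hf (x.hereditary _ hvx f ?_))
    obtain ⟨(ζ : Word k (n + 1) d'.1.idx), hζ⟩ := hed'
    refine Word.le_of_le_γ (Word.comp a.2 v) f.2 ((hN f hf).trans ((le_max_left _ _).trans hn))
      ⟨0, hkn⟩ ζ ?_
    have h1 : Word.comp (Word.comp a.2 v) (Word.cons 0 0 rfl ⟨0, hkn⟩ ζ) = d'.2 :=
      ((Word.assoc a.2 v _).trans ((congrArg _ (Word.comp_γ_comp v _ ζ).symm).trans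
        (Word.assoc a.2 _ ζ).symm)).trans hζ
    rw [h1]
    exact hfd'

/-- The boundary is invariant under the action of paths. -/
theorem act_mem_boundary_iff (hk : ∀ N, ∃ n ≥ N, 0 < k (n + 1)) {u w : Lam k} (μ : u ⟶ w)
    (x : DirHer w) : act μ x ∈ boundary u ↔ x ∈ boundary w := by
  rw [mem_boundary_iff hk, mem_boundary_iff hk]
  constructor
  · intro h N
    obtain ⟨a, ⟨b, hb, hab⟩, ha⟩ := h N
    exact ⟨b, hb, ha.trans (idx_le_of_isPrefix hab)⟩
  · intro h N
    obtain ⟨b, hb, hN⟩ := h N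
    exact ⟨pre μ b, (pre_mem_act μ x b).2 hb, hN⟩

theorem boundary_nonempty (u : Lam k) : (boundary u).Nonempty := by
  obtain ⟨y, -, hy⟩ := exists_maximal (principal (nil u))
  exact ⟨y, subset_closure hy⟩

/-! ### Decomposition of cylinders -/

theorem Z_pre_inter {u w : Lam k} (μ : u ⟶ w) (a b : From w) :
    Z (pre μ a) ∩ Z (pre μ b) = act μ '' (Z a ∩ Z b) := by
  rw [Set.image_inter (act_injective μ), act_image_Z, act_image_Z]

theorem disjoint_Z_last_cons {i n n' : ℕ} {p q : ℕ} (hpq : 0 < p + q) (h : i + p + q = n)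
    (j : Fin (k (i + 1))) (w : Word k (i + 1) n') :
    Z (path (Word.last p q h)) ∩ Z (path (Word.cons 0 0 rfl j w)) = ∅ := by
  refine Set.eq_empty_of_forall_notMem fun x ⟨h1, h2⟩ => ?_
  obtain ⟨d, -, h3, h4⟩ := x.directed _ h1 _ h2
  obtain ⟨z, hz, -⟩ := Word.eq_cons_of_cons_le (z := d.2) h4
  have h3 : Word.Le (Word.last p q h) d.2 := h3
  rw [hz, Word.last_le_cons] at h3
  omega

theorem disjoint_Z_cons_cons {i n n' : ℕ} {j j' : Fin (k (i + 1))} (hj : j ≠ j')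
    (w : Word k (i + 1) n) (w' : Word k (i + 1) n') :
    Z (path (Word.cons 0 0 rfl j w)) ∩ Z (path (Word.cons 0 0 rfl j' w')) = ∅ := by
  refine Set.eq_empty_of_forall_notMem fun x ⟨h1, h2⟩ => ?_
  obtain ⟨d, -, h3, h4⟩ := x.directed _ h1 _ h2
  obtain ⟨z, hz, -⟩ := Word.eq_cons_of_cons_le (z := d.2) h3
  obtain ⟨z', hz', -⟩ := Word.eq_cons_of_cons_le (z := d.2) h4
  rw [hz, Word.cons.injEq] at hz'
  exact hj (eq_of_heq hz'.2.2.2.1)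

theorem Z_α_inter_Z_β (i : ℕ) :
    Z (path (Word.last 1 0 rfl : Word k i _)) ∩ Z (path (Word.last 0 1 rfl)) =
      Z (path (Word.last 1 1 rfl)) := by
  refine Set.Subset.antisymm (fun x ⟨h1, h2⟩ => ?_) (fun x hx => ⟨?_, ?_⟩)
  · obtain ⟨d, hd, h3, h4⟩ := x.directed _ h1 _ h2
    exact x.hereditary _ hd _ (Word.αβ_le (d := d.2) h3 h4)
  · exact Z_anti (isPrefix_path.2 (Word.last_le_last.2 (by omega))) hx
  · exact Z_anti (isPrefix_path.2 (Word.last_le_last.2 (by omega))) hx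

/-- `Z(μ) = Z(μα) ∪ Z(μβ) ∪ ⋃ⱼ Z(μγ⁽ʲ⁾)` on the boundary, where only the first two sets meet, in
`Z(μαβ)`. -/
theorem measure_bZ_add (hk : ∀ N, ∃ n ≥ N, 0 < k (n + 1)) {u : Lam k} (m : Measure (boundary u))
    (a : From u) :
    m (bZ a) + m (bZ (pre a.2 (path (Word.last 1 1 rfl)))) =
      m (bZ (pre a.2 (path (Word.last 1 0 rfl)))) + m (bZ (pre a.2 (path (Word.last 0 1 rfl)))) +
      ∑ j, m (bZ (pre a.2 (path (Word.cons 0 0 rfl j (Word.last 0 0 rfl))))) := by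
  set A := bZ (pre a.2 (path (Word.last 1 0 rfl))) with hA
  set B := bZ (pre a.2 (path (Word.last 0 1 rfl))) with hB
  set G := fun j => bZ (pre a.2 (path (Word.cons 0 0 rfl j (Word.last 0 0 rfl)))) with hG
  have hAB : A ∩ B = bZ (pre a.2 (path (Word.last 1 1 rfl))) := by
    simp only [hA, hB, bZ]
    rw [← Set.preimage_inter, Z_pre_inter, Z_α_inter_Z_β, act_image_Z]
  have hdisj : Disjoint (A ∪ B) (⋃ j, G j) := by
    rw [Set.disjoint_iUnion_right]
    intro j
    rw [Set.disjoint_union_left]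
    constructor <;> rw [Set.disjoint_iff_inter_eq_empty] <;> simp only [hA, hB, hG, bZ] <;>
      rw [← Set.preimage_inter, Z_pre_inter, disjoint_Z_last_cons (by omega), Set.image_empty,
        Set.preimage_empty]
  have hGdisj : Pairwise (Function.onFun Disjoint G) := by
    intro j j' hj
    simp only [Function.onFun]
    rw [Set.disjoint_iff_inter_eq_empty]
    simp only [hG, bZ]
    rw [← Set.preimage_inter, Z_pre_inter, disjoint_Z_cons_cons hj, Set.image_empty,
      Set.preimage_empty]
  have hcover : bZ a = (A ∪ B) ∪ ⋃ j, G j := by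
    ext x
    constructor
    · intro hx
      obtain ⟨b, hb, hN⟩ := (mem_boundary_iff hk).1 x.2 (a.1.idx + 1)
      obtain ⟨d, hd, had, hbd⟩ := x.1.directed a hx b hb
      have := idx_le_of_isPrefix hbd
      rcases exists_edge_isPrefix had (by omega) with h | h | ⟨j, h⟩
      · exact Or.inl (Or.inl (x.1.hereditary _ hd _ h))
      · exact Or.inl (Or.inr (x.1.hereditary _ hd _ h))
      · exact Or.inr (Set.mem_iUnion.2 ⟨j, x.1.hereditary _ hd _ h⟩)
    · rintro ((h | h) | h)
      · exact Z_anti (isPrefix_pre a _) h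
      · exact Z_anti (isPrefix_pre a _) h
      · obtain ⟨j, h⟩ := Set.mem_iUnion.1 h
        exact Z_anti (isPrefix_pre a _) h
  rw [← hAB, ← measure_union_add_inter A (measurableSet_bZ _), hcover,
    measure_union hdisj (MeasurableSet.iUnion fun j => measurableSet_bZ _),
    measure_iUnion hGdisj (fun j => measurableSet_bZ _), tsum_fintype]
  ring

end Lam

/-! ### The continued fraction -/

section ContinuedFraction

theorem contFrac_nums_succ (g : ℕ → ℕ) (n : ℕ) : (contFrac g).nums (n + 2) =
    g (n + 2) * (contFrac g).nums (n + 1) + (contFrac g).nums n := by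
  rw [GenContFract.nums_recurrence (g := contFrac g) (n := n) (gp := ⟨1, g (n + 2)⟩) rfl rfl rfl]
  simp

theorem contFrac_dens_succ (g : ℕ → ℕ) (n : ℕ) : (contFrac g).dens (n + 2) =
    g (n + 2) * (contFrac g).dens (n + 1) + (contFrac g).dens n := by
  rw [GenContFract.dens_recurrence (g := contFrac g) (n := n) (gp := ⟨1, g (n + 2)⟩) rfl rfl rfl]
  simp

theorem contFrac_nums_zero (g : ℕ → ℕ) : (contFrac g).nums 0 = g 0 := rfl

theorem contFrac_dens_zero (g : ℕ → ℕ) : (contFrac g).dens 0 = 1 := rfl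

theorem contFrac_nums_one (g : ℕ → ℕ) : (contFrac g).nums 1 = g 1 * g 0 + 1 := by
  rw [GenContFract.first_num_eq (g := contFrac g) (gp := ⟨1, g 1⟩) rfl]
  rfl

theorem contFrac_dens_one (g : ℕ → ℕ) : (contFrac g).dens 1 = g 1 := by
  rw [GenContFract.first_den_eq (g := contFrac g) (gp := ⟨1, g 1⟩) rfl]

variable (k : ℕ → ℕ)

theorem θCoeff_even (n : ℕ) : θCoeff k (2 * n + 2) = k (n + 1) := by
  have h : ¬ Odd (2 * n + 2) := by rw [Nat.not_odd_iff_even]; exact ⟨n + 1, by omega⟩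
  rw [θCoeff, if_neg (by omega), if_neg h]
  congr 1
  omega

theorem θCoeff_odd (n : ℕ) : θCoeff k (2 * n + 1) = 1 := by
  rw [θCoeff, if_neg (by omega), if_pos ⟨n, rfl⟩]

/-- Numerators of `[0, 1, k₁, 1, k₂, …]`. -/
noncomputable def θNum (n : ℕ) : ℝ := (contFrac (θCoeff k)).nums n

/-- Denominators of `[0, 1, k₁, 1, k₂, …]`. -/
noncomputable def θDen (n : ℕ) : ℝ := (contFrac (θCoeff k)).dens n

theorem θNum_zero : θNum k 0 = 0 := by rw [θNum, contFrac_nums_zero]; simp [θCoeff]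

theorem θDen_zero : θDen k 0 = 1 := contFrac_dens_zero _

theorem θNum_one : θNum k 1 = 1 := by rw [θNum, contFrac_nums_one]; simp [θCoeff]

theorem θDen_one : θDen k 1 = 1 := by rw [θDen, contFrac_dens_one]; simp [θCoeff]

theorem θNum_even (n : ℕ) :
    θNum k (2 * n + 2) = k (n + 1) * θNum k (2 * n + 1) + θNum k (2 * n) := by
  simp only [θNum]
  rw [contFrac_nums_succ, θCoeff_even]

theorem θDen_even (n : ℕ) :
    θDen k (2 * n + 2) = k (n + 1) * θDen k (2 * n + 1) + θDen k (2 * n) := by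
  simp only [θDen]
  rw [contFrac_dens_succ, θCoeff_even]

theorem θNum_odd (n : ℕ) :
    θNum k (2 * n + 3) = θNum k (2 * n + 2) + θNum k (2 * n + 1) := by
  simp only [θNum]
  rw [contFrac_nums_succ, show 2 * n + 1 + 2 = 2 * (n + 1) + 1 by ring, θCoeff_odd]
  simp

theorem θDen_odd (n : ℕ) :
    θDen k (2 * n + 3) = θDen k (2 * n + 2) + θDen k (2 * n + 1) := by
  simp only [θDen]
  rw [contFrac_dens_succ, show 2 * n + 1 + 2 = 2 * (n + 1) + 1 by ring, θCoeff_odd]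
  simp

theorem θDen_bounds (n : ℕ) : 1 ≤ θDen k (2 * n) ∧ (n : ℝ) + 1 ≤ θDen k (2 * n + 1) := by
  induction n with
  | zero => simp [θDen_zero, θDen_one]
  | succ n ih =>
    have h1 : 1 ≤ θDen k (2 * n + 2) := by
      rw [θDen_even]
      have : (0 : ℝ) ≤ k (n + 1) * θDen k (2 * n + 1) :=
        mul_nonneg (Nat.cast_nonneg _) (by have := n.cast_nonneg (α := ℝ); linarith [ih.2])
      linarith [ih.1]
    refine ⟨h1, ?_⟩
    rw [show 2 * (n + 1) + 1 = 2 * n + 3 by ring, θDen_odd]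
    push_cast
    linarith [ih.2]

theorem θ_determinant (n : ℕ) :
    θNum k (2 * n + 1) * θDen k (2 * n) - θNum k (2 * n) * θDen k (2 * n + 1) = 1 := by
  induction n with
  | zero => simp [θNum_zero, θNum_one, θDen_zero, θDen_one]
  | succ n ih =>
    rw [show 2 * (n + 1) + 1 = 2 * n + 3 by ring, show 2 * (n + 1) = 2 * n + 2 by ring, θNum_odd,
      θDen_odd, θNum_even, θDen_even]
    linear_combination ih

/-- The convergents of even index. -/
noncomputable abbrev θLow (n : ℕ) : ℝ := θNum k (2 * n) / θDen k (2 * n)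

/-- The convergents of odd index. -/
noncomputable abbrev θUp (n : ℕ) : ℝ := θNum k (2 * n + 1) / θDen k (2 * n + 1)

theorem θDen_even_pos (n : ℕ) : 0 < θDen k (2 * n) := by linarith [(θDen_bounds k n).1]

theorem θDen_odd_pos (n : ℕ) : 0 < θDen k (2 * n + 1) := by
  have := n.cast_nonneg (α := ℝ)
  linarith [(θDen_bounds k n).2]

theorem θUp_sub_θLow (n : ℕ) :
    θUp k n - θLow k n = 1 / (θDen k (2 * n + 1) * θDen k (2 * n)) := by
  have h1 := (θDen_even_pos k n).ne'
  have h2 := (θDen_odd_pos k n).ne'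
  rw [θUp, θLow, div_sub_div _ _ h2 h1, ← θ_determinant k n]
  ring

theorem θLow_le_θUp (n : ℕ) : θLow k n ≤ θUp k n := by
  have := θUp_sub_θLow k n
  have h : 0 < 1 / (θDen k (2 * n + 1) * θDen k (2 * n)) :=
    one_div_pos.2 (mul_pos (θDen_odd_pos k n) (θDen_even_pos k n))
  linarith

theorem θUp_sub_θLow_le (n : ℕ) : θUp k n - θLow k n ≤ 1 / ((n : ℝ) + 1) := by
  rw [θUp_sub_θLow]
  refine one_div_le_one_div_of_le (by positivity) ?_
  have := θDen_bounds k n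
  have := n.cast_nonneg (α := ℝ)
  nlinarith

theorem θLow_mono : Monotone (θLow k) := by
  refine monotone_nat_of_le_succ fun n => ?_
  have h1 := θDen_even_pos k n
  have h2 := θDen_even_pos k (n + 1)
  rw [θLow, θLow, div_le_div_iff₀ h1 h2, show 2 * (n + 1) = 2 * n + 2 by ring, θNum_even, θDen_even]
  have := θ_determinant k n
  have hk : (0 : ℝ) ≤ k (n + 1) := Nat.cast_nonneg _
  nlinarith

theorem θUp_anti : Antitone (θUp k) := by
  refine antitone_nat_of_succ_le fun n => ?_
  have h1 := θDen_odd_pos k n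
  have h2 := θDen_odd_pos k (n + 1)
  rw [θUp, θUp, div_le_div_iff₀ h2 h1, show 2 * (n + 1) + 1 = 2 * n + 3 by ring, θNum_odd,
    θDen_odd, θNum_even, θDen_even]
  have := θ_determinant k n
  nlinarith

/-- The limit of `[0, 1, k₁, 1, k₂, …]`. -/
noncomputable def θLim : ℝ := ⨆ n, θLow k n

theorem θLow_le_θUp' (m n : ℕ) : θLow k m ≤ θUp k n :=
  (θLow_mono k (le_max_left m n)).trans
    ((θLow_le_θUp k _).trans (θUp_anti k (le_max_right m n)))

theorem θLow_le_θLim (n : ℕ) : θLow k n ≤ θLim k :=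
  le_ciSup ⟨θUp k 0, by rintro _ ⟨m, rfl⟩; exact θLow_le_θUp' k m 0⟩ n

theorem θLim_le_θUp (n : ℕ) : θLim k ≤ θUp k n := ciSup_le fun m => θLow_le_θUp' k m n

theorem tendsto_convs_θLim : Tendsto (contFrac (θCoeff k)).convs atTop (𝓝 (θLim k)) := by
  refine tendsto_iff_dist_tendsto_zero (f := fun n => (contFrac (θCoeff k)).convs n).2 ?_
  refine squeeze_zero (fun _ => dist_nonneg) (g := fun n : ℕ => 2 / ((n : ℝ) + 1)) (fun m => ?_) ?_
  · have hd : ∀ n : ℕ, 1 / ((n : ℝ) + 1) = 2 / (2 * n + 2) := fun n => by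
      field_simp
    rcases Nat.even_or_odd' m with ⟨n, rfl | rfl⟩
    · change dist (θLow k n) _ ≤ _
      have h : 2 / (2 * (n : ℝ) + 2) ≤ 2 / ((2 * n : ℕ) + 1) := by
        push_cast
        gcongr
        norm_num
      rw [Real.dist_eq, abs_of_nonpos (by linarith [θLow_le_θLim k n])]
      linarith [θLim_le_θUp k n, θUp_sub_θLow_le k n, hd n]
    · change dist (θUp k n) _ ≤ _
      have h : 2 / (2 * (n : ℝ) + 2) = 2 / ((2 * n + 1 : ℕ) + 1) := by
        push_cast
        congr 1
        ring
      rw [Real.dist_eq, abs_of_nonneg (by linarith [θLim_le_θUp k n])]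
      linarith [θLow_le_θLim k n, θUp_sub_θLow_le k n, hd n]
  · have := (tendsto_one_div_add_atTop_nhds_zero_nat (𝕜 := ℝ)).const_mul 2
    simpa [div_eq_mul_inv] using this

/-- The recurrence for the masses `M n` of cylinders determines the first difference `1 - M 1`:
by induction, `M n - M (n + 1)` and `M (n + 1)` are the errors `± (q (1 - M 1) - p)` of successive
convergents `p / q`, so their positivity places `1 - M 1` between all of these. -/
theorem eq_θLim_of_recurrence {M : ℕ → ℝ} (h0 : M 0 = 1) (hpos : ∀ n, 0 ≤ M n)
    (hanti : ∀ n, M (n + 1) ≤ M n)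
    (hrec : ∀ n, M n + M (n + 2) = (2 + k (n + 1)) * M (n + 1)) : 1 - M 1 = θLim k := by
  have key : ∀ n, M n - M (n + 1) = θDen k (2 * n) * (1 - M 1) - θNum k (2 * n) ∧
      M (n + 1) = θNum k (2 * n + 1) - θDen k (2 * n + 1) * (1 - M 1) := by
    intro n
    induction n with
    | zero => simp [θNum_zero, θNum_one, θDen_zero, θDen_one, h0]
    | succ n ih =>
      have h1 : M (n + 1) - M (n + 2) =
          θDen k (2 * n + 2) * (1 - M 1) - θNum k (2 * n + 2) := by
        rw [θDen_even, θNum_even]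
        linear_combination ih.1 + (-k (n + 1) : ℝ) * ih.2 - hrec n
      refine ⟨h1, ?_⟩
      rw [show 2 * (n + 1) + 1 = 2 * n + 3 by ring, θNum_odd, θDen_odd]
      linear_combination ih.2 - h1
  refine tendsto_nhds_unique (f := fun _ : ℕ => 1 - M 1) (l := atTop) tendsto_const_nhds ?_
  have hlow : Tendsto (θLow k) atTop (𝓝 (θLim k)) := (tendsto_convs_θLim k).comp
    (tendsto_atTop_mono (fun n => by simp only [id]; omega : ∀ n, id n ≤ 2 * n) tendsto_id)
  have hup : Tendsto (θUp k) atTop (𝓝 (θLim k)) := (tendsto_convs_θLim k).comp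
    (tendsto_atTop_mono (fun n => by simp only [id]; omega : ∀ n, id n ≤ 2 * n + 1) tendsto_id)
  refine tendsto_of_tendsto_of_tendsto_of_le_of_le hlow hup (fun n => ?_) (fun n => ?_)
  · simp only
    rw [θLow, div_le_iff₀ (θDen_even_pos k n)]
    linarith [(key n).1, hanti n]
  · simp only
    rw [θUp, le_div_iff₀ (θDen_odd_pos k n)]
    linarith [(key n).2, hpos (n + 1)]

/-- The mass of the cylinders `Z(μ)` with `s(μ) = v_{n+1}`: up to sign, the error `q θ - p` of the
convergent `p / q` of index `2 n - 1`. -/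
noncomputable def mass : ℕ → ℝ
  | 0 => 1
  | n + 1 => θNum k (2 * n + 1) - θDen k (2 * n + 1) * θLim k

theorem mass_nonneg (n : ℕ) : 0 ≤ mass k n := by
  cases n with
  | zero => exact zero_le_one
  | succ n =>
    have := θLim_le_θUp k n
    rw [θUp, le_div_iff₀ (θDen_odd_pos k n)] at this
    rw [mass]
    linarith

theorem mass_sub (n : ℕ) :
    mass k n - mass k (n + 1) = θDen k (2 * n) * θLim k - θNum k (2 * n) := by
  cases n with
  | zero => simp [mass, θNum_zero, θNum_one, θDen_zero, θDen_one]
  | succ n =>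
    rw [mass, mass, show 2 * (n + 1) + 1 = 2 * n + 3 by ring, θNum_odd, θDen_odd]
    ring_nf

theorem mass_anti (n : ℕ) : mass k (n + 1) ≤ mass k n := by
  have := θLow_le_θLim k n
  rw [θLow, div_le_iff₀ (θDen_even_pos k n)] at this
  linarith [mass_sub k n]

theorem mass_sub_eq (n : ℕ) : mass k n - mass k (n + 1) =
    k (n + 1) * mass k (n + 1) + (mass k (n + 1) - mass k (n + 2)) := by
  rw [mass_sub, mass_sub k (n + 1), mass, show 2 * (n + 1) = 2 * n + 2 by ring, θNum_even,
    θDen_even]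
  ring

theorem mass_zero_sub : 1 - mass k 1 = θLim k := by
  simp [mass, θNum_one, θDen_one]

variable {k}

/-- The masses tend to `0`: their limit `L` satisfies
`L ≤ k_{n+1} M_{n+1} ≤ M_n - M_{n+1}` for infinitely many `n`. -/
theorem tendsto_mass (hk : ∀ N, ∃ n ≥ N, 0 < k (n + 1)) : Tendsto (mass k) atTop (𝓝 0) := by
  have hanti : Antitone (mass k) := antitone_nat_of_succ_le (mass_anti k)
  have hbdd : BddBelow (Set.range (mass k)) := ⟨0, by rintro _ ⟨n, rfl⟩; exact mass_nonneg k n⟩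
  have hlim := tendsto_atTop_ciInf hanti hbdd
  have hd : Tendsto (fun n => mass k n - mass k (n + 1)) atTop (𝓝 0) := by
    simpa using hlim.sub (hlim.comp (tendsto_add_atTop_nat 1))
  have h0 : (⨅ n, mass k n) ≤ 0 := by
    refine ge_of_tendsto_of_frequently hd (frequently_atTop.2 fun N => ?_)
    obtain ⟨n, hn, hkn⟩ := hk N
    refine ⟨n, hn, ?_⟩
    have h1 : (1 : ℝ) ≤ k (n + 1) := by exact_mod_cast hkn
    have h2 : mass k (n + 1) ≤ k (n + 1) * mass k (n + 1) :=
      le_mul_of_one_le_left (mass_nonneg k _) h1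
    linarith [ciInf_le hbdd (n + 1), mass_sub_eq k n, mass_anti k (n + 1)]
  have h1 : 0 ≤ ⨅ n, mass k n := le_ciInf (mass_nonneg k)
  rwa [le_antisymm h0 h1] at hlim

/-- The mass of `Z(μ) \ Z(μα)` is carried by the cylinders `Z(μβ^qγ)`. -/
theorem hasSum_γ (hk : ∀ N, ∃ n ≥ N, 0 < k (n + 1)) (n : ℕ) :
    HasSum (fun q => k (n + q + 1) * mass k (n + q + 1)) (mass k n - mass k (n + 1)) := by
  rw [hasSum_iff_tendsto_nat_of_nonneg
    (fun q => mul_nonneg (Nat.cast_nonneg _) (mass_nonneg k _))]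
  have hs : ∀ N, ∑ q ∈ Finset.range N, (k (n + q + 1) * mass k (n + q + 1)) =
      (mass k n - mass k (n + 1)) - (mass k (n + N) - mass k (n + N + 1)) := by
    intro N
    induction N with
    | zero => simp
    | succ N ih =>
      rw [Finset.sum_range_succ, ih]
      have := mass_sub_eq k (n + N)
      rw [show n + (N + 1) = n + N + 1 by ring]
      linarith
  simp only [hs]
  have h1 : Tendsto (fun N => mass k (n + N)) atTop (𝓝 0) := by
    have := (tendsto_add_atTop_iff_nat n).2 (tendsto_mass hk)
    simpa only [add_comm] using this
  have h2 : Tendsto (fun N => mass k (n + N + 1)) atTop (𝓝 0) := h1.comp (tendsto_add_atTop_nat 1)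
  simpa using tendsto_const_nhds.sub (h1.sub h2)

theorem hasSum_mass_sub (hk : ∀ N, ∃ n ≥ N, 0 < k (n + 1)) (n : ℕ) :
    HasSum (fun p => mass k (n + p) - mass k (n + p + 1)) (mass k n) := by
  rw [hasSum_iff_tendsto_nat_of_nonneg (fun p => sub_nonneg.2 (mass_anti k _))]
  have hs : ∀ N, ∑ p ∈ Finset.range N, (mass k (n + p) - mass k (n + p + 1)) =
      mass k n - mass k (n + N) := by
    intro N
    exact Finset.sum_range_sub' (fun p => mass k (n + p)) N
  simp only [hs]
  have h1 : Tendsto (fun N => mass k (n + N)) atTop (𝓝 0) := by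
    have := (tendsto_add_atTop_iff_nat n).2 (tendsto_mass hk)
    simpa only [add_comm] using this
  simpa using tendsto_const_nhds.sub h1

/-- The paths `α^p β^q γ` account for all of the mass. -/
theorem tsum_tsum_mass (hk : ∀ N, ∃ n ≥ N, 0 < k (n + 1)) (n : ℕ) :
    ∑' p, ∑' q, (k (n + p + q + 1) : ENNReal) * ENNReal.ofReal (mass k (n + p + q + 1)) =
      ENNReal.ofReal (mass k n) := by
  have h1 : ∀ p, ∑' q, (k (n + p + q + 1) : ENNReal) * ENNReal.ofReal (mass k (n + p + q + 1)) =
      ENNReal.ofReal (mass k (n + p) - mass k (n + p + 1)) := by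
    intro p
    rw [← (hasSum_γ hk (n + p)).tsum_eq, ENNReal.ofReal_tsum_of_nonneg
      (fun q => mul_nonneg (Nat.cast_nonneg _) (mass_nonneg k _)) (hasSum_γ hk (n + p)).summable]
    refine tsum_congr fun q => ?_
    rw [ENNReal.ofReal_mul (Nat.cast_nonneg _), ENNReal.ofReal_natCast]
  simp only [h1]
  rw [← (hasSum_mass_sub hk n).tsum_eq, ENNReal.ofReal_tsum_of_nonneg
    (fun p => sub_nonneg.2 (mass_anti k _)) (hasSum_mass_sub hk n).summable]

end ContinuedFraction

/-! ### Construction of a measure with prescribed values on cylinders -/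

namespace Lam

open PathCat

variable {k : ℕ → ℕ}

/-- The action of a path as a map between boundaries. -/
def actB (hk : ∀ N, ∃ n ≥ N, 0 < k (n + 1)) {u w : Lam k} (μ : u ⟶ w) (x : boundary w) :
    boundary u :=
  ⟨act μ x.1, (act_mem_boundary_iff hk μ x.1).2 x.2⟩

theorem continuous_actB (hk : ∀ N, ∃ n ≥ N, 0 < k (n + 1)) {u w : Lam k} (μ : u ⟶ w) :
    Continuous (actB hk μ) :=
  ((continuous_act μ).comp continuous_subtype_val).subtype_mk _

theorem actB_injective (hk : ∀ N, ∃ n ≥ N, 0 < k (n + 1)) {u w : Lam k} (μ : u ⟶ w) :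
    Function.Injective (actB hk μ) :=
  fun _ _ h => Subtype.ext (act_injective μ (congrArg Subtype.val h))

/-- The path `α^p β^q γ`. -/
def block {i : ℕ} (p q : ℕ) (j : Fin (k (i + p + q + 1))) :
    (⟨i⟩ : Lam k) ⟶ ⟨i + p + q + 1⟩ :=
  Word.cons p q rfl j (Word.last 0 0 rfl)

theorem pre_block {i n : ℕ} (p q : ℕ) (j : Fin (k (i + p + q + 1)))
    (w : Word k (i + p + q + 1) n) : pre (block p q j) (path w) = path (Word.cons p q rfl j w) := by
  change path (Word.comp (Word.cons p q rfl j (Word.last 0 0 rfl)) w) = _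
  rw [Word.comp, Word.id_comp]

theorem actB_block_preimage_last (hk : ∀ N, ∃ n ≥ N, 0 < k (n + 1)) {i n : ℕ} (p q : ℕ)
    (j : Fin (k (i + p + q + 1))) (p₀ q₀ : ℕ) (h : i + p₀ + q₀ = n) :
    actB hk (block p q j) ⁻¹' bZ (path (Word.last p₀ q₀ h)) =
      if p₀ ≤ p ∧ q₀ ≤ q then Set.univ else ∅ := by
  have key : ∀ b : From (⟨i + p + q + 1⟩ : Lam k),
      IsPrefix (path (Word.last p₀ q₀ h)) (pre (block p q j) b) ↔ p₀ ≤ p ∧ q₀ ≤ q := by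
    rintro ⟨⟨l⟩, b⟩
    have : pre (block p q j) ⟨⟨l⟩, b⟩ = _ := pre_block p q j b
    rw [this, isPrefix_path, Word.last_le_cons]
  ext x
  have : x ∈ actB hk (block p q j) ⁻¹' bZ (path (Word.last p₀ q₀ h)) ↔ p₀ ≤ p ∧ q₀ ≤ q := by
    constructor
    · rintro ⟨b, -, hb⟩
      exact (key b).1 hb
    · intro h
      obtain ⟨b, hb⟩ := x.1.nonempty
      exact ⟨b, hb, (key b).2 h⟩
  rw [this]
  split_ifs with h <;> simp [h]

theorem actB_block_preimage_cons (hk : ∀ N, ∃ n ≥ N, 0 < k (n + 1)) {i n : ℕ} (p q : ℕ)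
    (j : Fin (k (i + p + q + 1))) (w : Word k (i + p + q + 1) n) :
    actB hk (block p q j) ⁻¹' bZ (path (Word.cons p q rfl j w)) = bZ (path w) := by
  rw [← pre_block]
  change Subtype.val ⁻¹' (act (block p q j) ⁻¹' Z _) = _
  rw [act_preimage_Z_pre]
  rfl

theorem actB_block_preimage_cons_of_ne (hk : ∀ N, ∃ n ≥ N, 0 < k (n + 1)) {i n : ℕ} (p q : ℕ)
    (j : Fin (k (i + p + q + 1))) (p₀ q₀ : ℕ) (j₀ : Fin (k (i + p₀ + q₀ + 1)))
    (w : Word k (i + p₀ + q₀ + 1) n) (hne : ¬ (p = p₀ ∧ q = q₀ ∧ HEq j j₀)) :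
    actB hk (block p q j) ⁻¹' bZ (path (Word.cons p₀ q₀ rfl j₀ w)) = ∅ := by
  refine Set.eq_empty_of_forall_notMem ?_
  rintro x ⟨⟨⟨l⟩, b⟩, -, hb⟩
  have : pre (block p q j) ⟨⟨l⟩, b⟩ = _ := pre_block p q j b
  rw [this, isPrefix_path] at hb
  obtain ⟨z, hz, -⟩ := Word.eq_cons_of_cons_le hb
  rw [Word.cons.injEq] at hz
  exact hne ⟨hz.2.1, hz.2.2.1, hz.2.2.2.1⟩

/-- Measures on the boundaries that converge to the invariant measure. Each step replaces the
measure `m_i` at every vertex by `∑ (α^p β^q γ^{(j)})_* m_{i+p+q+1}`, so that after `r` steps the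
cylinders `Z(μ)` for paths `μ` with fewer than `r` edges `γ` have the right mass. -/
noncomputable def approx (hk : ∀ N, ∃ n ≥ N, 0 < k (n + 1)) :
    ℕ → (i : ℕ) → Measure (boundary (⟨i⟩ : Lam k))
  | 0, i => ENNReal.ofReal (mass k i) •
      Measure.dirac ⟨(boundary_nonempty ⟨i⟩).choose, (boundary_nonempty ⟨i⟩).choose_spec⟩
  | r + 1, i => Measure.sum fun p => Measure.sum fun q => ∑ j,
      (approx hk r (i + p + q + 1)).map (actB hk (block p q j))

theorem approx_succ_apply (hk : ∀ N, ∃ n ≥ N, 0 < k (n + 1)) (r i : ℕ)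
    {S : Set (boundary (⟨i⟩ : Lam k))} (hS : MeasurableSet S) :
    approx hk (r + 1) i S =
      ∑' p, ∑' q, ∑ j, approx hk r (i + p + q + 1) (actB hk (block p q j) ⁻¹' S) := by
  rw [approx, Measure.sum_apply _ hS]
  refine tsum_congr fun p => ?_
  rw [Measure.sum_apply _ hS]
  refine tsum_congr fun q => ?_
  rw [Measure.finsetSum_apply]
  exact Finset.sum_congr rfl fun j _ =>
    Measure.map_apply (continuous_actB hk _).measurable hS

theorem approx_univ (hk : ∀ N, ∃ n ≥ N, 0 < k (n + 1)) (r i : ℕ) :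
    approx hk r i Set.univ = ENNReal.ofReal (mass k i) := by
  induction r generalizing i with
  | zero => simp [approx]
  | succ r ih =>
    rw [approx_succ_apply hk r i MeasurableSet.univ, ← tsum_tsum_mass hk i]
    refine tsum_congr fun p => tsum_congr fun q => ?_
    simp [ih]

theorem tsum_ite_le (f : ℕ → ENNReal) (p₀ : ℕ) :
    ∑' p, (if p₀ ≤ p then f p else 0) = ∑' p, f (p₀ + p) := by
  rw [← (add_right_injective p₀).tsum_eq (f := fun p => if p₀ ≤ p then f p else 0)]
  · simp
  · intro p hp
    by_cases h : p₀ ≤ p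
    · exact ⟨p - p₀, by simp [h]⟩
    · simp [h] at hp

/-- The approximating measures have the right mass on each cylinder from some stage on. -/
theorem approx_bZ (hk : ∀ N, ∃ n ≥ N, 0 < k (n + 1)) {i n : ℕ} (w : Word k i n) :
    ∃ R, ∀ r ≥ R, approx hk r i (bZ (path w)) = ENNReal.ofReal (mass k n) := by
  induction w with
  | @last i n p₀ q₀ h =>
    refine ⟨1, fun r hr => ?_⟩
    obtain ⟨r, rfl⟩ : ∃ r', r = r' + 1 := ⟨r - 1, by omega⟩
    rw [approx_succ_apply hk r i (measurableSet_bZ _)]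
    have h1 : ∀ p q, ∑ j, approx hk r (i + p + q + 1)
        (actB hk (block p q j) ⁻¹' bZ (path (Word.last p₀ q₀ h))) =
        if p₀ ≤ p then (if q₀ ≤ q then
          (k (i + p + q + 1) : ENNReal) * ENNReal.ofReal (mass k (i + p + q + 1)) else 0) else 0 := by
      intro p q
      simp only [actB_block_preimage_last]
      split_ifs with h1 h2 h3 h4 <;> simp_all [approx_univ]
    have h2 : ∀ p, ∑' q, (if p₀ ≤ p then (if q₀ ≤ q then
          (k (i + p + q + 1) : ENNReal) * ENNReal.ofReal (mass k (i + p + q + 1)) else 0) else 0) =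
        if p₀ ≤ p then ∑' q, (k (i + p + (q₀ + q) + 1) : ENNReal) *
          ENNReal.ofReal (mass k (i + p + (q₀ + q) + 1)) else 0 := by
      intro p
      split_ifs with h
      · exact tsum_ite_le (fun q => (k (i + p + q + 1) : ENNReal) *
          ENNReal.ofReal (mass k (i + p + q + 1))) q₀
      · simp
    simp only [h1, h2]
    rw [tsum_ite_le, ← h, ← tsum_tsum_mass hk]
    refine tsum_congr fun p => tsum_congr fun q => ?_
    rw [show i + (p₀ + p) + (q₀ + q) + 1 = i + p₀ + q₀ + p + q + 1 by ring]
  | @cons i l n p₀ q₀ h j₀ w ih =>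
    subst h
    obtain ⟨R, hR⟩ := ih
    refine ⟨R + 1, fun r hr => ?_⟩
    obtain ⟨r, rfl⟩ : ∃ r', r = r' + 1 := ⟨r - 1, by omega⟩
    rw [approx_succ_apply hk r i (measurableSet_bZ _), tsum_eq_single p₀, tsum_eq_single q₀,
      Finset.sum_eq_single j₀, actB_block_preimage_cons, hR r (by omega)]
    · intro j _ hj
      rw [actB_block_preimage_cons_of_ne hk _ _ _ _ _ _ _ (fun h => hj (eq_of_heq h.2.2)),
        measure_empty]
    · simp
    · intro q hq
      refine Finset.sum_eq_zero fun j _ => ?_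
      rw [actB_block_preimage_cons_of_ne hk _ _ _ _ _ _ _ (fun h => hq h.2.1), measure_empty]
    · intro p hp
      refine ENNReal.tsum_eq_zero.2 fun q => Finset.sum_eq_zero fun j _ => ?_
      rw [actB_block_preimage_cons_of_ne hk _ _ _ _ _ _ _ (fun h => hp h.1), measure_empty]

instance (u : Lam k) : CompactSpace (boundary u) :=
  isCompact_iff_compactSpace.1 isClosed_closure.isCompact

/-- A limit point of the approximating measures. -/
theorem exists_measure_bZ (hk : ∀ N, ∃ n ≥ N, 0 < k (n + 1)) :
    ∃ m : Measure (boundary (⟨0⟩ : Lam k)), IsProbabilityMeasure m ∧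
      ∀ {n : ℕ} (w : Word k 0 n), m (bZ (path w)) = ENNReal.ofReal (mass k n) := by
  let f : ℕ → ProbabilityMeasure (boundary (⟨0⟩ : Lam k)) := fun r =>
    ⟨approx hk r 0, ⟨by simp [approx_univ, mass]⟩⟩
  obtain ⟨m, -, hm⟩ := isCompact_univ.ultrafilter_le_nhds
    (Ultrafilter.map f (hyperfilter ℕ)) (by simp)
  have hm : Tendsto f (hyperfilter ℕ) (𝓝 m) := hm
  refine ⟨m, inferInstance, fun {n} w => ?_⟩
  have hclopen : IsClopen (bZ (path w)) :=
    ⟨(isClosed_Z _).preimage continuous_subtype_val, (isOpen_Z _).preimage continuous_subtype_val⟩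
  have h1 := ProbabilityMeasure.tendsto_measure_of_null_frontier_of_tendsto' hm
    (E := bZ (path w)) (by simp [hclopen.frontier_eq])
  refine tendsto_nhds_unique h1 (tendsto_const_nhds.congr' ?_)
  obtain ⟨R, hR⟩ := approx_bZ hk w
  filter_upwards [Nat.hyperfilter_le_atTop (eventually_ge_atTop R)] with r hr
  exact (hR r hr).symm

end Lam

/-! ### Invariant measures -/

namespace Lam

open PathCat

variable {k : ℕ → ℕ}

theorem actB_image (hk : ∀ N, ∃ n ≥ N, 0 < k (n + 1)) {u w : Lam k} (μ : u ⟶ w)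
    (O : Set (DirHer w)) : actB hk μ '' (Subtype.val ⁻¹' O) = Subtype.val ⁻¹' (act μ '' O) := by
  ext x
  constructor
  · rintro ⟨y, hy, rfl⟩
    exact ⟨y.1, hy, rfl⟩
  · rintro ⟨y, hy, hyx⟩
    exact ⟨⟨y, (act_mem_boundary_iff hk μ y).1 (hyx ▸ x.2)⟩, hy, Subtype.ext hyx⟩

theorem actB_image_bZ (hk : ∀ N, ∃ n ≥ N, 0 < k (n + 1)) {u w : Lam k} (μ : u ⟶ w)
    (a : From w) : actB hk μ '' bZ a = bZ (pre μ a) := by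
  rw [bZ, actB_image, act_image_Z, bZ]

theorem isOpenMap_actB (hk : ∀ N, ∃ n ≥ N, 0 < k (n + 1)) {u w : Lam k} (μ : u ⟶ w) :
    IsOpenMap (actB hk μ) := by
  rintro _ ⟨O, hO, rfl⟩
  rw [actB_image]
  exact (isOpenMap_act μ O hO).preimage continuous_subtype_val

theorem measurableEmbedding_actB (hk : ∀ N, ∃ n ≥ N, 0 < k (n + 1)) {u w : Lam k} (μ : u ⟶ w) :
    MeasurableEmbedding (actB hk μ) :=
  (IsOpenEmbedding.of_continuous_injective_isOpenMap (continuous_actB hk μ) (actB_injective hk μ)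
    (isOpenMap_actB hk μ)).measurableEmbedding

/-- If the measure of a cylinder `Z(μ)` depends on `s(μ)` only, then `μV` and `νV` have the same
measure for all Borel sets `V`. -/
theorem measure_actB_image (hk : ∀ N, ∃ n ≥ N, 0 < k (n + 1)) {u w : Lam k}
    {m : Measure (boundary u)} [IsFiniteMeasure m]
    (hm : ∀ {w : Lam k} (μ ν : u ⟶ w), m (bZ ⟨w, μ⟩) = m (bZ ⟨w, ν⟩)) (μ ν : u ⟶ w)
    (V : Set (boundary w)) : m (actB hk μ '' V) = m (actB hk ν '' V) := by
  have hμ := measurableEmbedding_actB hk μ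
  have hν := measurableEmbedding_actB hk ν
  rw [← hμ.comap_apply, ← hν.comap_apply]
  have : IsFiniteMeasure (m.comap (actB hk μ)) := ⟨by
    rw [hμ.comap_apply]
    exact measure_lt_top m _⟩
  rw [measure_ext_bZ (m := m.comap (actB hk μ)) (m' := m.comap (actB hk ν)) fun a => ?_]
  rw [hμ.comap_apply, hν.comap_apply, actB_image_bZ, actB_image_bZ]
  exact hm _ _

/-- The arrow `[μ, ν, x]` of the groupoid over the boundary. -/
def arrow (hk : ∀ N, ∃ n ≥ N, 0 < k (n + 1)) {u w : Lam k} (μ ν : u ⟶ w) (x : boundary w) :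
    BdryGroupoid u :=
  ⟨Arrows.mk μ ν x.1, (actB hk μ x).2, (actB hk ν x).2⟩

theorem continuous_arrow (hk : ∀ N, ∃ n ≥ N, 0 < k (n + 1)) {u w : Lam k} (μ ν : u ⟶ w) :
    Continuous (arrow hk μ ν) :=
  ((continuous_mk μ ν).comp continuous_subtype_val).subtype_mk _

theorem exists_arrow_eq (hk : ∀ N, ∃ n ≥ N, 0 < k (n + 1)) {u : Lam k} (g : BdryGroupoid u) :
    ∃ (w : Lam k) (μ ν : u ⟶ w) (x : boundary w), arrow hk μ ν x = g := by
  obtain ⟨g, hr, hs⟩ := g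
  obtain ⟨⟨w, μ, ν, x⟩, rfl⟩ := Quot.exists_rep g
  exact ⟨w, μ, ν, ⟨x, (act_mem_boundary_iff hk μ x).1 hr⟩, rfl⟩

/-- Measures for which the mass of `Z(μ)` depends on `s(μ)` only are invariant: an open bisection
is a disjoint union of countably many sets `{[μ, ν, x] | x ∈ V}` with `V` Borel. -/
theorem isInvariant_of_bZ (hk : ∀ N, ∃ n ≥ N, 0 < k (n + 1)) {u : Lam k}
    {m : Measure (boundary u)} [IsFiniteMeasure m]
    (hm : ∀ {w : Lam k} (μ ν : u ⟶ w), m (bZ ⟨w, μ⟩) = m (bZ ⟨w, ν⟩)) : IsInvariant m := by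
  rintro E ⟨hE, hrange, hsource⟩
  let ι := Σ w : Lam k, (u ⟶ w) × (u ⟶ w)
  have : Nonempty ι := ⟨⟨u, 𝟙 u, 𝟙 u⟩⟩
  obtain ⟨e, he⟩ := exists_surjective_nat ι
  -- the triples `(s(μ), μ, ν)` are enumerated by `e`; `U n` parametrizes the part of `E` consisting
  -- of the arrows `[μ, ν, x]`, and these parts are made disjoint through their sources
  let U : ∀ n, Set (boundary (e n).1) := fun n => arrow hk (e n).2.1 (e n).2.2 ⁻¹' E
  let S : ℕ → Set (boundary u) := fun n => actB hk (e n).2.2 '' U n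
  have hS : ∀ n, MeasurableSet (S n) := fun n => (isOpenMap_actB hk _ _
    (hE.preimage (continuous_arrow hk _ _))).measurableSet
  let V : ∀ n, Set (boundary (e n).1) := fun n => actB hk (e n).2.2 ⁻¹' disjointed S n
  have hVU : ∀ n, V n ⊆ U n := by
    intro n x hx
    obtain ⟨y, hy, hyx⟩ := disjointed_subset S n hx
    rwa [← actB_injective hk _ hyx]
  have hVm : ∀ n, MeasurableSet (V n) := fun n =>
    (MeasurableSet.disjointed hS n).preimage (continuous_actB hk _).measurable
  have hD : ∀ n, actB hk (e n).2.2 '' V n = disjointed S n := by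
    intro n
    refine Set.image_preimage_eq_of_subset ((disjointed_subset S n).trans ?_)
    exact Set.image_subset_range _ _
  have hcover : ∀ g ∈ E, ∃ n, ∃ x ∈ V n, arrow hk (e n).2.1 (e n).2.2 x = g := by
    intro g hg
    obtain ⟨w, μ, ν, x, rfl⟩ := exists_arrow_eq hk g
    obtain ⟨n, hn⟩ := he ⟨w, μ, ν⟩
    have hx : (arrow hk μ ν x).source ∈ ⋃ n, S n := by
      refine Set.mem_iUnion.2 ⟨n, ?_⟩
      simp only [S, U]
      rw [hn]
      exact ⟨x, hg, rfl⟩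
    rw [← iUnion_disjointed] at hx
    obtain ⟨n', hn'⟩ := Set.mem_iUnion.1 hx
    rw [← hD] at hn'
    obtain ⟨y, hy, hyx⟩ := hn'
    exact ⟨n', y, hy, hsource (hVU n' hy) hg hyx⟩
  have hs : BdryGroupoid.source '' E = ⋃ n, actB hk (e n).2.2 '' V n := by
    ext x
    constructor
    · rintro ⟨g, hg, rfl⟩
      obtain ⟨n, y, hy, rfl⟩ := hcover g hg
      exact Set.mem_iUnion.2 ⟨n, y, hy, rfl⟩
    · intro hx
      obtain ⟨n, y, hy, rfl⟩ := Set.mem_iUnion.1 hx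
      exact ⟨_, hVU n hy, rfl⟩
  have hr : BdryGroupoid.range '' E = ⋃ n, actB hk (e n).2.1 '' V n := by
    ext x
    constructor
    · rintro ⟨g, hg, rfl⟩
      obtain ⟨n, y, hy, rfl⟩ := hcover g hg
      exact Set.mem_iUnion.2 ⟨n, y, hy, rfl⟩
    · intro hx
      obtain ⟨n, y, hy, rfl⟩ := Set.mem_iUnion.1 hx
      exact ⟨_, hVU n hy, rfl⟩
  rw [hs, hr, measure_iUnion, measure_iUnion]
  · exact tsum_congr fun n => measure_actB_image hk hm _ _ _
  · intro n n' hnn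
    rw [Function.onFun, Set.disjoint_left]
    rintro _ ⟨x, hx, rfl⟩ ⟨y, hy, hyx⟩
    have hxy : arrow hk (e n').2.1 (e n').2.2 y = arrow hk (e n).2.1 (e n).2.2 x :=
      hrange (hVU n' hy) (hVU n hx) hyx
    have hxy' : actB hk (e n').2.2 y = actB hk (e n).2.2 x := congrArg BdryGroupoid.source hxy
    exact Set.disjoint_left.1 (disjoint_disjointed S hnn) hx (hxy' ▸ hy)
  · exact fun n => (measurableEmbedding_actB hk _).measurableSet_image.2 (hVm n)
  · intro n n' hnn
    rw [Function.onFun, hD, hD]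
    exact disjoint_disjointed S hnn
  · exact fun n => (measurableEmbedding_actB hk _).measurableSet_image.2 (hVm n)

/-- The bisection of all arrows `[μ, ν, x]` shows that the mass of a cylinder `Z(μ)` under an
invariant measure depends on `s(μ)` only. -/
theorem bZ_eq_of_isInvariant (hk : ∀ N, ∃ n ≥ N, 0 < k (n + 1)) {u w : Lam k}
    {m : Measure (boundary u)} (hm : IsInvariant m) (μ ν : u ⟶ w) :
    m (bZ ⟨w, μ⟩) = m (bZ ⟨w, ν⟩) := by
  let E : Set (BdryGroupoid u) := Set.range (arrow hk μ ν)
  have hE' : E = Subtype.val ⁻¹' Set.range (Arrows.mk μ ν) := by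
    ext g
    constructor
    · rintro ⟨x, rfl⟩
      exact ⟨x.1, rfl⟩
    · rintro ⟨x, hx⟩
      have hr : (Arrows.mk μ ν x).range ∈ boundary u := hx ▸ g.2.1
      exact ⟨⟨x, (act_mem_boundary_iff hk μ x).1 hr⟩, Subtype.ext hx⟩
  have hE : IsOpenBisection E := by
    refine ⟨?_, ?_, ?_⟩
    · rw [hE']
      exact (isOpen_range_mk μ ν).preimage continuous_subtype_val
    · rintro _ ⟨x, rfl⟩ _ ⟨y, rfl⟩ h
      rw [actB_injective hk μ h]
    · rintro _ ⟨x, rfl⟩ _ ⟨y, rfl⟩ h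
      rw [actB_injective hk ν h]
  have key : ∀ μ : u ⟶ w, Set.range (actB hk μ) = bZ ⟨w, μ⟩ := by
    intro μ
    have := actB_image_bZ hk μ (nil w)
    rwa [pre_nil, bZ, Z_nil, Set.preimage_univ, Set.image_univ] at this
  have h := hm E hE
  simp only [E] at h
  rw [← Set.range_comp, ← Set.range_comp] at h
  rw [← key, ← key]
  exact h.symm

theorem real_bZ_add (hk : ∀ N, ∃ n ≥ N, 0 < k (n + 1)) {i n : ℕ}
    (m : Measure (boundary (⟨i⟩ : Lam k))) [IsFiniteMeasure m] (w : Word k i n) :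
    m.real (bZ (path w)) + m.real (bZ (path (w.comp (Word.last 1 1 rfl)))) =
      m.real (bZ (path (w.comp (Word.last 1 0 rfl)))) +
      m.real (bZ (path (w.comp (Word.last 0 1 rfl)))) +
      ∑ j : Fin (k (n + 1)),
        m.real (bZ (path (w.comp (Word.cons 0 0 rfl j (Word.last 0 0 rfl))))) := by
  have h : m (bZ (path w)) + m (bZ (path (w.comp (Word.last 1 1 rfl)))) =
      m (bZ (path (w.comp (Word.last 1 0 rfl)))) + m (bZ (path (w.comp (Word.last 0 1 rfl)))) +
      ∑ j : Fin (k (n + 1)), m (bZ (path (w.comp (Word.cons 0 0 rfl j (Word.last 0 0 rfl))))) :=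
    measure_bZ_add hk m (path w)
  have h' := congrArg ENNReal.toReal h
  rwa [ENNReal.toReal_add (measure_ne_top _ _) (measure_ne_top _ _),
    ENNReal.toReal_add (by finiteness) (ENNReal.sum_ne_top.2 fun j _ => measure_ne_top _ _),
    ENNReal.toReal_add (measure_ne_top _ _) (measure_ne_top _ _),
    ENNReal.toReal_sum (fun j _ => measure_ne_top _ _)] at h'

/-- The values of an invariant probability measure on cylinders. -/
theorem bZ_eq_mass_of_isInvariant (hk : ∀ N, ∃ n ≥ N, 0 < k (n + 1))
    {m : Measure (boundary (⟨0⟩ : Lam k))} [IsProbabilityMeasure m] (hm : IsInvariant m)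
    {n : ℕ} (w : Word k 0 n) : m (bZ (path w)) = ENNReal.ofReal (mass k n) := by
  let M : ℕ → ℝ := fun n => m.real (bZ (path (Word.last n 0 (by omega) : Word k 0 n)))
  have hM : ∀ {n : ℕ} (w : Word k 0 n), m.real (bZ (path w)) = M n := by
    intro n w
    exact congrArg ENNReal.toReal (bZ_eq_of_isInvariant hk hm (w := ⟨n⟩) w _)
  have h0 : M 0 = 1 := by
    have : bZ (path (Word.last 0 0 (by omega) : Word k 0 0)) = Set.univ := by
      change Subtype.val ⁻¹' Z (nil (⟨0⟩ : Lam k)) = _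
      rw [Z_nil, Set.preimage_univ]
    simp only [M]
    rw [this, probReal_univ]
  have hanti : ∀ n, M (n + 1) ≤ M n := fun n => measureReal_mono
    (Set.preimage_mono (Z_anti (isPrefix_path.2 (Word.last_le_last.2 (by omega)))))
  have hrec : ∀ n, M n + M (n + 2) = (2 + k (n + 1)) * M (n + 1) := by
    intro n
    have h := real_bZ_add hk m (Word.last n 0 (by omega) : Word k 0 n)
    rw [hM (n := n + 2), hM (n := n + 1), hM (n := n + 1),
      Finset.sum_congr rfl fun j _ => hM (n := n + 1) _] at h
    simp only [Finset.sum_const, Finset.card_univ, Fintype.card_fin, nsmul_eq_mul] at h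
    linear_combination h
  have hθ := eq_θLim_of_recurrence k h0 (fun n => measureReal_nonneg) hanti hrec
  have hmass : ∀ n, M n = mass k n ∧ M (n + 1) = mass k (n + 1) := by
    intro n
    induction n with
    | zero => exact ⟨h0, by linarith [mass_zero_sub k]⟩
    | succ n ih =>
      refine ⟨ih.2, ?_⟩
      have h1 := hrec n
      have h2 := mass_sub_eq k n
      rw [ih.1, ih.2] at h1
      change M (n + 2) = mass k (n + 2)
      linear_combination h1 - h2
  rw [← (hmass n).1, ← hM w, ofReal_measureReal]

end Lam

/-- Infinitely many `k_i` are positive. -/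
theorem IsAttached.exists_pos {σ : ℝ} {c k : ℕ → ℕ} (hc : IsSimpleExpansion σ c)
    (hk : IsAttached c k) (N : ℕ) : ∃ n ≥ N, 0 < k (n + 1) := by
  have h : ∀ p, p + 2 ≤ blockIndex c p := by
    intro p
    induction p with
    | zero => simp [blockIndex]
    | succ p ih =>
      have := hc.pos (2 * p + 1) (by omega)
      rw [blockIndex] at ih ⊢
      rw [Finset.sum_range_succ]
      omega
  have h1 := h (N + 1)
  refine ⟨blockIndex c (N + 1) - 1, by omega, ?_⟩
  rw [Nat.sub_add_cancel (by omega), hk.at_pos]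
  exact hc.pos _ (by omega)

theorem mainTheorem7 (σ : ℝ) (hσ : Irrational σ) (hσpos : 0 < σ) (c : ℕ → ℕ)
    (hc : IsSimpleExpansion σ c) (k : ℕ → ℕ) (hk : IsAttached c k) :
    ∃ θ : ℝ, Tendsto (contFrac (θCoeff k)).convs atTop (𝓝 θ) ∧
      ∃ m : Measure (UnitSpace k),
        IsProbabilityMeasure m ∧ PathCat.IsInvariant (u := Lam.v₁ k) m ∧ m.real (complZβ k) = θ ∧
        ∀ m' : Measure (UnitSpace k),
          IsProbabilityMeasure m' → PathCat.IsInvariant (u := Lam.v₁ k) m' → m' = m := by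
  have hk := hk.exists_pos hc
  obtain ⟨m, hprob, hm⟩ := Lam.exists_measure_bZ hk
  refine ⟨θLim k, tendsto_convs_θLim k, m, hprob, ?_, ?_, ?_⟩
  · exact Lam.isInvariant_of_bZ hk fun {w} μ ν => (hm (n := w.idx) μ).trans (hm (n := w.idx) ν).symm
  · have h : complZβ k = (PathCat.bZ (Lam.path (Word.last 0 1 rfl : Word k 0 1)))ᶜ := rfl
    rw [h, probReal_compl_eq_one_sub (PathCat.measurableSet_bZ _), Measure.real, hm,
      ENNReal.toReal_ofReal (mass_nonneg k 1), mass_zero_sub]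
  · intro m' hprob' hinv
    exact PathCat.measure_ext_bZ fun a =>
      (Lam.bZ_eq_mass_of_isInvariant hk hinv (n := a.1.idx) a.2).trans (hm (n := a.1.idx) a.2).symm
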